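/- Let $d,T\ge 1$, let $(\Omega,\mathcal F,\mathbb P)$ be a standard Borel probability space carrying independent standard Gaussian random vectors $G_1,\dots,G_T$ in $\mathbb R^d$, let $\mathcal G_t=\sigma(G_s:s\le t)$, and let $L^2_{\rm ad}$ be the set of square-integrable $(\mathcal G_t)$-adapted $\mathbb R^d$-valued processes $(X_t)_{t=1}^T$. For such processes, $X\sim_{\rm ad}Y$ means that the nested conditional laws $\mathrm{law}(\mathrm{law}(\dots\mathrm{law}(X|\mathcal G_{T-1})\dots|\mathcal G_1))$ and $\mathrm{law}(\mathrm{law}(\dots\mathrm{law}(Y|\mathcal G_{T-1})\dots|\mathcal G_1))$ coincide, and $$\mathcal{AW}_2^2(X,Y)=\inf\{\mathbb E|X'-Y'|^2: X',Y'\in L^2_{\rm ad},\ X'\sim_{\rm ad}X,\ Y'\sim_{\rm ad}Y\}.$$ Let $\mathbf L$ be the set of real block-lower triangular $dT\times dT$ matrices with $d\times d$ blocks, let $\mathbf O$ be the set of block-diagonal matrices with $d\times d$ orthogonal diagonal blocks, and write $[L]=\{LO:O\in\mathbf O\}$ for $L\in\mathbf L$. Then $d_{\rm ABW}([L],[M]):=\mathcal{AW}_2(LG,MG)$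 is a well-defined metric on $\mathbf L/_{\mathbf O}=\{[L]:L\in\mathbf L\}$. Fix $L\in\mathbf L$. Let $\Gamma^*$ be the set of non-constant constant speed geodesics $\gamma:[0,1]\to(\mathbf L/_{\mathbf O},d_{\rm ABW})$ with $\gamma(0)=[L]$. For $\gamma,\eta\in\Gamma^*$ the limit $$\cos\angle(\gamma,\eta)=\lim_{u\downarrow0}\frac{d_{\rm ABW}^2([L],\gamma(u))+d_{\rm ABW}^2([L],\eta(u))-d_{\rm ABW}^2(\gamma(u),\eta(u))}{2\,d_{\rm ABW}([L],\gamma(u))\,d_{\rm ABW}([L],\eta(u))}$$ exists and the resulting angle $\angle$, with values in $[0,\pi]$, is a pseudometric on $\Gamma^*$. Let $\overline\Gamma$ be the completion of the metric quotient $\Gamma^*/_\angle$ (its metric is still written $\angle$). The tangent cone $\mathbf T([L])$ is $\overline\Gamma\times[0,\infty)$ with all points $(\gamma,0)$ identified, endowed with $$d_{\mathbf T([L])}^2((\gamma,r),(\eta,s))=r^2+s^2-2rs\cos\angle(\gamma,\eta).$$ Let $\mathbf O^*(L,L)$ be the set of minimizers of $O\mapsto\|L-LO\|_{\rm F}$ over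 $\mathbf O$ (equivalently, $\{O\in\mathbf O:LO=L\}$), and let $$\mathcal V(L)=\{V\in\mathbf L:\ (V^\top L)_{t,t}\text{ is symmetric for all }t=1,\dots,T\},\qquad d_{\mathbf O^*(L,L)}(V,W)=\inf_{O\in\mathbf O^*(L,L)}\|V-WO\|_{\rm F}.$$ Let $\mathcal V(L)/_{\mathbf O^*(L,L)}$ be the metric quotient of $\mathcal V(L)$ by the pseudo-distance $d_{\mathbf O^*(L,L)}$. **Theorem.** For every $L\in\mathbf L$ there is a bijective isometry $$\iota_L:(\mathbf T([L]),d_{\mathbf T([L])})\to(\mathcal V(L)/_{\mathbf O^*(L,L)},d_{\mathbf O^*(L,L)}).$$ -/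

import Mathlib

open MeasureTheory ProbabilityTheory Filter Topology Matrix

noncomputable section

namespace AdaptedBW

/-! ### Adapted optimal transport on a Gaussian stochastic basis

Times `1, …, T` are indexed by `Fin T` (time `t` is the index `t - 1`), and a process is a
family `X : Fin T → Ω → ℝᵈ`. -/

/-- `G` consists of `T` independent, standard Gaussian, `ℝᵈ`-valued random vectors. -/
structure IsGaussianBasis {Ω : Type*} [MeasurableSpace Ω] (P : Measure Ω) {T d : ℕ}
    (G : Fin T → Ω → EuclideanSpace ℝ (Fin d)) : Prop where
  measurable : ∀ t, Measurable (G t)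
  indep : iIndepFun G P
  law : ∀ t, P.map (G t) = stdGaussian (EuclideanSpace ℝ (Fin d))

/-- The `σ`-algebra `𝓖ₙ` generated by the first `n` of the random vectors `G`. -/
@[reducible]
def pastSigma {Ω : Type*} {T d : ℕ} (G : Fin T → Ω → EuclideanSpace ℝ (Fin d)) (n : ℕ) :
    MeasurableSpace Ω :=
  ⨆ s : {s : Fin T // (s : ℕ) < n}, MeasurableSpace.comap (G s) inferInstance

/-- The regular conditional law of the random variable `X` given the `σ`-algebra `m`,
as a random measure. -/
def condLaw {Ω : Type*} (m : MeasurableSpace Ω) [MeasurableSpace Ω] [StandardBorelSpace Ω]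
    (P : Measure Ω) [IsProbabilityMeasure P] {α : Type*} [MeasurableSpace α] (X : Ω → α) :
    Ω → Measure α :=
  fun ω => (condExpKernel P m ω).map X

/-- Equality of the nested conditional laws
`law(law(… law(X | 𝓕 n) … | 𝓕 1)) = law(law(… law(Y | 𝓕 n) … | 𝓕 1))`. -/
def SameNestedLaw {Ω : Type*} [MeasurableSpace Ω] [StandardBorelSpace Ω] (P : Measure Ω)
    [IsProbabilityMeasure P] (𝓕 : ℕ → MeasurableSpace Ω) :
    (n : ℕ) → {α : Type} → [MeasurableSpace α] → (X Y : Ω → α) → Prop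
  | 0, _, _, X, Y => P.map X = P.map Y
  | n + 1, _, _, X, Y => SameNestedLaw P 𝓕 n (condLaw (𝓕 (n + 1)) P X) (condLaw (𝓕 (n + 1)) P Y)

/-- `X ∼_ad Y`: the processes have the same adapted distribution, with respect to the
filtration generated by `G`. -/
def SameAdaptedLaw {Ω : Type*} [MeasurableSpace Ω] [StandardBorelSpace Ω] (P : Measure Ω)
    [IsProbabilityMeasure P] {T d : ℕ} (G : Fin T → Ω → EuclideanSpace ℝ (Fin d))
    (X Y : Fin T → Ω → EuclideanSpace ℝ (Fin d)) : Prop :=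
  SameNestedLaw P (pastSigma G) (T - 1) (fun ω t => X t ω) (fun ω t => Y t ω)

/-- `X ∈ L²_ad`: the process `X` is adapted to the filtration generated by `G` and
square-integrable. -/
def IsAdaptedL2 {Ω : Type*} [MeasurableSpace Ω] (P : Measure Ω) {T d : ℕ}
    (G : Fin T → Ω → EuclideanSpace ℝ (Fin d))
    (X : Fin T → Ω → EuclideanSpace ℝ (Fin d)) : Prop :=
  ∀ t : Fin T, Measurable[pastSigma G (t + 1)] (X t) ∧ MemLp (X t) 2 P

/-- The adapted Wasserstein distance `𝓐𝓦₂(X, Y)`, with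
`𝓐𝓦₂²(X, Y) = inf { 𝔼|X' - Y'|² : X' ∼_ad X, Y' ∼_ad Y }`. -/
def adaptedW2 {Ω : Type*} [MeasurableSpace Ω] [StandardBorelSpace Ω] (P : Measure Ω)
    [IsProbabilityMeasure P] {T d : ℕ} (G : Fin T → Ω → EuclideanSpace ℝ (Fin d))
    (X Y : Fin T → Ω → EuclideanSpace ℝ (Fin d)) : ℝ :=
  √(sInf {c : ℝ | ∃ X' Y' : Fin T → Ω → EuclideanSpace ℝ (Fin d),
      IsAdaptedL2 P G X' ∧ IsAdaptedL2 P G Y' ∧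
      SameAdaptedLaw P G X' X ∧ SameAdaptedLaw P G Y' Y ∧
      c = ∫ ω, ∑ t, ‖X' t ω - Y' t ω‖ ^ 2 ∂P})

/-! ### Block matrices

A `dT × dT` matrix is indexed by pairs `(i, t)`, with `t : Fin T` the block and `i : Fin d` the
position inside the block. -/

/-- Real `dT × dT` matrices. -/
abbrev BMat (T d : ℕ) : Type := Matrix (Fin d × Fin T) (Fin d × Fin T) ℝ

/-- The `d × d` block `A_{t,s}`. -/
def block {T d : ℕ} (A : BMat T d) (t s : Fin T) : Matrix (Fin d) (Fin d) ℝ :=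
  A.submatrix (fun i => (i, t)) (fun j => (j, s))

/-- The set `𝐋` of block-lower triangular matrices. -/
def bL (T d : ℕ) : Set (BMat T d) := {A | ∀ t s : Fin T, t < s → block A t s = 0}

/-- The set `𝐎` of block-diagonal matrices with orthogonal diagonal blocks. -/
def bO (T d : ℕ) : Set (BMat T d) :=
  {O | ∃ U : Fin T → Matrix (Fin d) (Fin d) ℝ,
    (∀ t, U t ∈ Matrix.orthogonalGroup (Fin d) ℝ) ∧ O = Matrix.blockDiagonal U}

/-- The Frobenius norm. -/
def frob {T d : ℕ} (A : BMat T d) : ℝ := √(∑ p, ∑ q, A p q ^ 2)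

/-- The process `LG`, `(LG)_t = ∑ₛ L_{t,s} Gₛ`. -/
def linProcess {Ω : Type*} {T d : ℕ} (G : Fin T → Ω → EuclideanSpace ℝ (Fin d)) (L : BMat T d) :
    Fin T → Ω → EuclideanSpace ℝ (Fin d) :=
  fun t ω => ∑ s, WithLp.toLp 2 (block L t s *ᵥ (G s ω).ofLp)

/-- `d_ABW(L, M) = 𝓐𝓦₂(LG, MG)`. -/
def dABW {Ω : Type*} [MeasurableSpace Ω] [StandardBorelSpace Ω] (P : Measure Ω)
    [IsProbabilityMeasure P] {T d : ℕ} (G : Fin T → Ω → EuclideanSpace ℝ (Fin d))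
    (L M : BMat T d) : ℝ :=
  adaptedW2 P G (linProcess G L) (linProcess G M)

/-- `𝐎*(L, M)`: the set of minimizers of `O ↦ ‖L - MO‖_F` over `𝐎`. -/
def Ostar {T d : ℕ} (L M : BMat T d) : Set (BMat T d) :=
  {O | O ∈ bO T d ∧ ∀ O' ∈ bO T d, frob (L - M * O) ≤ frob (L - M * O')}

/-- `𝓥(L) = {V ∈ 𝐋 : (Vᵀ L)_{t,t} is symmetric for all t}`. -/
def calV {T d : ℕ} (L : BMat T d) : Set (BMat T d) :=
  {V | V ∈ bL T d ∧ ∀ t, (block (Vᵀ * L) t t).IsSymm}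

/-! ### Facts needed for the quotients to make sense -/

lemma bO_one (T d : ℕ) : (1 : BMat T d) ∈ bO T d :=
  ⟨fun _ => 1, fun _ => one_mem _, Matrix.blockDiagonal_one.symm⟩

lemma bO_mul {T d : ℕ} {A B : BMat T d} (hA : A ∈ bO T d) (hB : B ∈ bO T d) :
    A * B ∈ bO T d := by
  obtain ⟨U, hU, rfl⟩ := hA
  obtain ⟨W, hW, rfl⟩ := hB
  exact ⟨fun t => U t * W t, fun t => mul_mem (hU t) (hW t), (Matrix.blockDiagonal_mul U W).symm⟩

lemma bO_transpose {T d : ℕ} {A : BMat T d} (hA : A ∈ bO T d) : Aᵀ ∈ bO T d := by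
  obtain ⟨U, hU, rfl⟩ := hA
  refine ⟨fun t => (U t)ᵀ, fun t => ?_, Matrix.blockDiagonal_transpose U⟩
  have h := Unitary.star_mem (hU t)
  simpa [Matrix.star_eq_conjTranspose] using h

lemma bO_mul_transpose {T d : ℕ} {A : BMat T d} (hA : A ∈ bO T d) : A * Aᵀ = 1 := by
  obtain ⟨U, hU, rfl⟩ := hA
  rw [Matrix.blockDiagonal_transpose, ← Matrix.blockDiagonal_mul, ← Matrix.blockDiagonal_one]
  congr 1
  funext t
  have h := (Matrix.mem_orthogonalGroup_iff (Fin d) ℝ).1 (hU t)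
  simpa [Matrix.star_eq_conjTranspose] using h

lemma frob_nonneg {T d : ℕ} (A : BMat T d) : 0 ≤ frob A := Real.sqrt_nonneg _

lemma frob_zero {T d : ℕ} : frob (0 : BMat T d) = 0 := by simp [frob]

lemma frob_eq_norm {T d : ℕ} (A : BMat T d) :
    frob A = ‖(WithLp.toLp 2 fun x : (Fin d × Fin T) × (Fin d × Fin T) => A x.1 x.2 :
      EuclideanSpace ℝ ((Fin d × Fin T) × (Fin d × Fin T)))‖ := by
  rw [EuclideanSpace.norm_eq, frob, ← Fintype.sum_prod_type']
  simp

lemma frob_add_le {T d : ℕ} (A B : BMat T d) : frob (A + B) ≤ frob A + frob B := by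
  simp only [frob_eq_norm]
  exact norm_add_le
    (WithLp.toLp 2 fun x : (Fin d × Fin T) × (Fin d × Fin T) => A x.1 x.2)
    (WithLp.toLp 2 fun x : (Fin d × Fin T) × (Fin d × Fin T) => B x.1 x.2)

lemma frob_neg {T d : ℕ} (A : BMat T d) : frob (-A) = frob A := by simp [frob]

lemma frob_eq_trace {T d : ℕ} (A : BMat T d) : frob A = √(A * Aᵀ).trace := by
  simp [frob, Matrix.trace, Matrix.mul_apply, sq]

lemma frob_mul {T d : ℕ} (A : BMat T d) {O : BMat T d} (hO : O ∈ bO T d) :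
    frob (A * O) = frob A := by
  rw [frob_eq_trace, frob_eq_trace, Matrix.transpose_mul, Matrix.mul_assoc, ← Matrix.mul_assoc O,
    bO_mul_transpose hO, Matrix.one_mul]

lemma frob_eq_zero {T d : ℕ} {A : BMat T d} (h : frob A = 0) : A = 0 := by
  rw [frob_eq_norm, norm_eq_zero] at h
  ext p q
  simpa using congrArg (fun v => v.ofLp (p, q)) h

/-- The minimizers `𝐎*(L, L)` form the stabilizer of `L`. -/
lemma mem_Ostar_self {T d : ℕ} {L O : BMat T d} : O ∈ Ostar L L ↔ O ∈ bO T d ∧ L * O = L := by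
  constructor
  · rintro ⟨hO, h⟩
    have h1 := h 1 (bO_one T d)
    rw [Matrix.mul_one, sub_self, frob_zero] at h1
    exact ⟨hO, (sub_eq_zero.1 (frob_eq_zero (le_antisymm h1 (frob_nonneg _)))).symm⟩
  · rintro ⟨hO, h⟩
    refine ⟨hO, fun O' _ => ?_⟩
    rw [h, sub_self, frob_zero]
    exact frob_nonneg _

/-! ### The adapted Bures–Wasserstein space -/

/-- `L ∼_𝐎 M` if and only if `L = MO` for some `O ∈ 𝐎`. -/
def orbitSetoid (T d : ℕ) : Setoid (bL T d) where
  r L M := ∃ O ∈ bO T d, (L : BMat T d) = M * O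
  iseqv :=
    { refl := fun L => ⟨1, bO_one T d, (Matrix.mul_one _).symm⟩
      symm := by
        rintro L M ⟨O, hO, h⟩
        exact ⟨Oᵀ, bO_transpose hO, by
          rw [h, Matrix.mul_assoc, bO_mul_transpose hO, Matrix.mul_one]⟩
      trans := by
        rintro L M N ⟨O, hO, h⟩ ⟨Q, hQ, h'⟩
        exact ⟨Q * O, bO_mul hQ hO, by rw [h, h', Matrix.mul_assoc]⟩ }

/-- The quotient `𝐋/𝐎`. -/
def ABWSpace (T d : ℕ) : Type := Quotient (orbitSetoid T d)

/-- The class `[L] ∈ 𝐋/𝐎`. -/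
def cls {T d : ℕ} (L : bL T d) : ABWSpace T d := Quotient.mk (orbitSetoid T d) L

/-! ### The space `𝓥(L)` with its pseudo-distance -/

/-- `d_{𝐎*(L,L)}(V, W) = inf { ‖V - WO‖_F : O ∈ 𝐎*(L,L) }`. -/
def distOstar {T d : ℕ} (L V W : BMat T d) : ℝ := ⨅ O : Ostar L L, frob (V - W * (O : BMat T d))

/-- The type of elements of `𝓥(L)`. -/
def VSpace {T d : ℕ} (L : BMat T d) : Type := {V : BMat T d // V ∈ calV L}

lemma distOstar_le {T d : ℕ} {L O : BMat T d} (hO : O ∈ Ostar L L) (V W : BMat T d) :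
    distOstar L V W ≤ frob (V - W * O) :=
  ciInf_le (f := fun O : Ostar L L => frob (V - W * (O : BMat T d)))
    ⟨0, by rintro _ ⟨O, rfl⟩; exact frob_nonneg _⟩ ⟨O, hO⟩

lemma one_mem_Ostar {T d : ℕ} (L : BMat T d) : (1 : BMat T d) ∈ Ostar L L :=
  mem_Ostar_self.2 ⟨bO_one T d, Matrix.mul_one L⟩

lemma le_distOstar {T d : ℕ} {L V W : BMat T d} {c : ℝ}
    (h : ∀ O ∈ Ostar L L, c ≤ frob (V - W * O)) : c ≤ distOstar L V W :=
  haveI : Nonempty (Ostar L L) := ⟨⟨1, one_mem_Ostar L⟩⟩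
  le_ciInf fun O => h O O.2

/-- `𝓥(L)` endowed with the pseudo-distance `d_{𝐎*(L,L)}`. -/
instance VSpace.pseudoMetricSpace {T d : ℕ} (L : BMat T d) : PseudoMetricSpace (VSpace L) where
  dist V W := distOstar L V.1 W.1
  dist_self V := by
    refine le_antisymm ?_ (le_distOstar fun _ _ => frob_nonneg _)
    simpa [frob_zero] using distOstar_le (one_mem_Ostar L) V.1 V.1
  dist_comm := by
    have key : ∀ V W : BMat T d, distOstar L V W ≤ distOstar L W V := by
      intro V W
      refine le_distOstar fun O hO => ?_
      obtain ⟨hO1, hO2⟩ := mem_Ostar_self.1 hO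
      have hT : Oᵀ ∈ Ostar L L := mem_Ostar_self.2 ⟨bO_transpose hO1, by
        nth_rewrite 1 [← hO2]
        rw [Matrix.mul_assoc, bO_mul_transpose hO1, Matrix.mul_one]⟩
      refine (distOstar_le hT V W).trans (le_of_eq ?_)
      rw [← frob_mul (W - V * O) (bO_transpose hO1), ← frob_neg, Matrix.sub_mul, Matrix.mul_assoc,
        bO_mul_transpose hO1, Matrix.mul_one, neg_sub]
    exact fun V W => le_antisymm (key _ _) (key _ _)
  dist_triangle U V W := by
    rw [← sub_le_iff_le_add]
    refine le_distOstar fun Q hQ => ?_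
    rw [sub_le_iff_le_add, add_comm, ← sub_le_iff_le_add]
    refine le_distOstar fun O hO => ?_
    rw [sub_le_iff_le_add]
    obtain ⟨hO1, hO2⟩ := mem_Ostar_self.1 hO
    obtain ⟨hQ1, hQ2⟩ := mem_Ostar_self.1 hQ
    have hOQ : O * Q ∈ Ostar L L :=
      mem_Ostar_self.2 ⟨bO_mul hO1 hQ1, by rw [← Matrix.mul_assoc, hO2, hQ2]⟩
    have e : U.1 - W.1 * (O * Q) = (V.1 - W.1 * O) * Q + (U.1 - V.1 * Q) := by
      rw [Matrix.sub_mul, Matrix.mul_assoc]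
      abel
    calc distOstar L U.1 W.1 ≤ frob (U.1 - W.1 * (O * Q)) := distOstar_le hOQ _ _
      _ ≤ frob ((V.1 - W.1 * O) * Q) + frob (U.1 - V.1 * Q) := by rw [e]; exact frob_add_le _ _
      _ = frob (V.1 - W.1 * O) + frob (U.1 - V.1 * Q) := by rw [frob_mul _ hQ1]

/-- The metric quotient `𝓥(L)/𝐎*(L,L)`, in which points at pseudo-distance `0` are identified;
it carries the distance induced by `d_{𝐎*(L,L)}`. -/
abbrev VQuot {T d : ℕ} (L : BMat T d) : Type := SeparationQuotient (VSpace L)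

/-! ### Tangent cones of metric spaces -/

/-- The non-constant constant speed geodesics `γ : [0,1] → S` with `γ 0 = x`. -/
structure Geod {S : Type*} [MetricSpace S] (x : S) where
  toFun : unitInterval → S
  start : toFun 0 = x
  const_speed : ∀ u v : unitInterval,
    dist (toFun u) (toFun v) = |(u : ℝ) - v| * dist (toFun 0) (toFun 1)
  nonconst : ∃ u, toFun u ≠ x

/-- The cosine `α(x, y, z)` of the Euclidean comparison angle at `x`. -/
def compCos {S : Type*} [MetricSpace S] (x y z : S) : ℝ :=
  (dist x y ^ 2 + dist x z ^ 2 - dist y z ^ 2) / (2 * dist x y * dist x z)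

/-- The pseudo-metric `a` on the non-constant geodesics emanating from `x` is the angle
`∠ ∈ [0, π]`, `cos ∠(γ, η) = lim_{u ↓ 0} α(x, γ u, η u)`. In particular all these limits exist.
This property determines `a`. -/
def IsAngleMetric {S : Type*} [MetricSpace S] (x : S) (a : PseudoMetricSpace (Geod x)) : Prop :=
  ∀ γ η : Geod x, a.dist γ η ≤ Real.pi ∧
    Tendsto (fun u : unitInterval => compCos x (γ.toFun u) (η.toFun u)) (𝓝[>] 0)
      (𝓝 (Real.cos (a.dist γ η)))

/-- `(p, r) ∼ (q, s)` if and only if they are equal or `r = s = 0`. -/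
def tipSetoid (X : Type*) : Setoid (X × NNReal) where
  r p q := p = q ∨ (p.2 = 0 ∧ q.2 = 0)
  iseqv :=
    { refl := fun p => Or.inl rfl
      symm := by
        rintro p q (h | ⟨h, h'⟩)
        · exact Or.inl h.symm
        · exact Or.inr ⟨h', h⟩
      trans := by
        rintro p q r (rfl | ⟨h, h'⟩) (rfl | ⟨k, k'⟩)
        · exact Or.inl rfl
        · exact Or.inr ⟨k, k'⟩
        · exact Or.inr ⟨h, h'⟩
        · exact Or.inr ⟨h, k'⟩ }

/-- The cone `(X × [0,∞))/tip` over `X`. -/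
def Cone (X : Type*) : Type _ := Quotient (tipSetoid X)

/-- The cone distance, `d²((p,r),(q,s)) = r² + s² - 2rs cos d(p,q)`. -/
def coneDist {X : Type*} [MetricSpace X] (a b : Cone X) : ℝ :=
  Quotient.liftOn₂ a b
    (fun p q => √((p.2 : ℝ) ^ 2 + (q.2 : ℝ) ^ 2 - 2 * p.2 * q.2 * Real.cos (dist p.1 q.1))) (by
      rintro p q p' q' (rfl | ⟨h, h'⟩) (rfl | ⟨k, k'⟩)
      · rfl
      · simp [k, k']
      · simp [h, h']
      · simp [h, h', k, k'])

/-- The tangent cone: the cone over the completion of the quotient of the set of non-constant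
geodesics emanating from `x` by the relation of having angle `0`. Its metric is `coneDist`. -/
abbrev TangentCone {S : Type*} [MetricSpace S] (x : S) [PseudoMetricSpace (Geod x)] : Type _ :=
  Cone (UniformSpace.Completion (SeparationQuotient (Geod x)))

end AdaptedBW

end

/-! The proof first computes d_ABW. If X has the adapted law of LG, the nested law fixes the Gram
matrices of the conditional expectations of X at all times (`SameAdaptedLaw.condGram_eq`), hence
those of its martingale increments: A Aᵀ, with A the block column of L at that time. Increments at
different times are orthogonal, so the correlation of X with a copy Y of MG splits over time. If O
minimizes ‖L - MO‖, the diagonal blocks of (MO)ᵀL are symmetric positive semidefinite, and their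
traces bound the terms (`sum_inner_le_trace`). The pair LG, MOG attains the bound, since rotating
each noise vector preserves adapted laws (`sameAdaptedLaw_linProcess_mul`). So d_ABW is the distance
between 𝐎-orbits (`dABW_eq_orbitDist`), and what remains is the geometry of a Euclidean space modulo
a compact group of isometries.

There 𝓥(L) is the space of normal vectors to the orbit at L. Every geodesic from [L] lifts to a ray
L + uV with V normal (`Geod.exists_ray`), because successive optimal lifts give equality in the
triangle inequality. Conversely normal rays minimize for short times (`exists_geod`), because ⟨L -
LO, V⟩ is of order ‖L - LO‖² (`exists_abs_matInner_le_of_mem_calV`). The same estimate for two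
normal vectors shows that the orbit distance of L + uV and L + uW is u d(V, W) + o(u), with d the
distance modulo the stabilizer of L (`tendsto_orbitDist_ray_div`): rotations away from the
stabilizer cost too much. Hence angles of geodesics are angles of normal vectors modulo the
stabilizer, and the cone distance is the law of cosines. The unit sphere of 𝓥(L) is compact, so the
completion adds no direction (`exists_geod_eq`), and sending (p, r) to the vector of length r in
direction p is the isometry (`coneIso`). -/

noncomputable section

namespace AdaptedBW

/-! ### The Frobenius inner product -/

section FrobeniusInner

variable {m n k : Type*} [Fintype m] [Fintype n] [Fintype k]

/-- The Frobenius inner product of two real matrices. -/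
def matInner (A B : Matrix m n ℝ) : ℝ := ∑ p, ∑ q, A p q * B p q

lemma matInner_eq_trace (A B : Matrix m n ℝ) : matInner A B = (Aᵀ * B).trace := by
  simp only [matInner, Matrix.trace, Matrix.diag, Matrix.mul_apply, Matrix.transpose_apply]
  exact Finset.sum_comm

lemma matInner_comm (A B : Matrix m n ℝ) : matInner A B = matInner B A := by
  simp [matInner, mul_comm]

lemma matInner_add_left (A B C : Matrix m n ℝ) :
    matInner (A + B) C = matInner A C + matInner B C := by
  simp [matInner, add_mul, Finset.sum_add_distrib]

lemma matInner_sub_left (A B C : Matrix m n ℝ) :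
    matInner (A - B) C = matInner A C - matInner B C := by
  simp [matInner, sub_mul, Finset.sum_sub_distrib]

lemma matInner_smul_left (c : ℝ) (A B : Matrix m n ℝ) :
    matInner (c • A) B = c * matInner A B := by
  simp [matInner, mul_assoc, Finset.mul_sum]

lemma matInner_add_right (A B C : Matrix m n ℝ) :
    matInner A (B + C) = matInner A B + matInner A C := by
  simp [matInner, mul_add, Finset.sum_add_distrib]

lemma matInner_sub_right (A B C : Matrix m n ℝ) :
    matInner A (B - C) = matInner A B - matInner A C := by
  simp [matInner, mul_sub, Finset.sum_sub_distrib]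

lemma matInner_smul_right (c : ℝ) (A B : Matrix m n ℝ) :
    matInner A (c • B) = c * matInner A B := by
  rw [matInner_comm, matInner_smul_left, matInner_comm]

lemma matInner_self_nonneg (A : Matrix m n ℝ) : 0 ≤ matInner A A :=
  Finset.sum_nonneg fun _ _ => Finset.sum_nonneg fun _ _ => mul_self_nonneg _

lemma matInner_self_eq_zero {A : Matrix m n ℝ} (h : matInner A A = 0) : A = 0 := by
  have h1 := (Finset.sum_eq_zero_iff_of_nonneg
    fun _ _ => Finset.sum_nonneg fun _ _ => mul_self_nonneg _).1 h
  ext p q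
  have h2 := (Finset.sum_eq_zero_iff_of_nonneg fun _ _ => mul_self_nonneg _).1
    (h1 p (Finset.mem_univ _)) q (Finset.mem_univ _)
  simpa using h2

/-- The matrix `A`, as a vector in Euclidean space. -/
def matVec (A : Matrix m n ℝ) : EuclideanSpace ℝ (m × n) := WithLp.toLp 2 fun x => A x.1 x.2

lemma inner_matVec (A B : Matrix m n ℝ) : inner ℝ (matVec A) (matVec B) = matInner A B := by
  simp [matVec, matInner, PiLp.inner_apply, Fintype.sum_prod_type, mul_comm]

lemma norm_matVec (A : Matrix m n ℝ) : ‖matVec A‖ = √(matInner A A) := by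
  rw [norm_eq_sqrt_real_inner, inner_matVec]

lemma abs_matInner_le (A B : Matrix m n ℝ) :
    |matInner A B| ≤ √(matInner A A) * √(matInner B B) := by
  rw [← inner_matVec, ← norm_matVec, ← norm_matVec]
  exact abs_real_inner_le_norm _ _

lemma matInner_mul_self_le (A : Matrix m k ℝ) (B : Matrix k n ℝ) :
    matInner (A * B) (A * B) ≤ matInner A A * matInner B B := by
  have h : matInner B B = ∑ q, ∑ r, B r q ^ 2 := by
    rw [matInner, Finset.sum_comm]
    simp [sq]
  rw [h, matInner, matInner, Finset.sum_mul_sum]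
  refine Finset.sum_le_sum fun p _ => Finset.sum_le_sum fun q _ => ?_
  rw [← sq, Matrix.mul_apply]
  simpa [sq] using Finset.sum_mul_sq_le_sq_mul_sq Finset.univ (fun r => A p r) (fun r => B r q)

/-- A generalized inverse of a real matrix. -/
lemma exists_generalized_inverse [DecidableEq n] (A : Matrix m n ℝ) :
    ∃ g : Matrix n m ℝ, A * g * A = A ∧ (g * A)ᵀ = g * A := by
  have hS : (Aᵀ * A).IsHermitian := by
    simpa [Matrix.conjTranspose_eq_transpose_of_trivial] using
      Matrix.isHermitian_conjTranspose_mul_self A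
  obtain ⟨H, hH, hsymm⟩ : ∃ H : Matrix n n ℝ, Aᵀ * A * H * (Aᵀ * A) = Aᵀ * A ∧
      (H * (Aᵀ * A))ᵀ = H * (Aᵀ * A) := by
    obtain ⟨U, D, hU, hD⟩ : ∃ (U : Matrix n n ℝ) (D : n → ℝ), Uᵀ * U = 1 ∧
        Aᵀ * A = U * Matrix.diagonal D * Uᵀ := by
      refine ⟨hS.eigenvectorUnitary, hS.eigenvalues, ?_, ?_⟩
      · have := (Matrix.mem_unitaryGroup_iff' (A := (hS.eigenvectorUnitary : Matrix n n ℝ))).1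
          hS.eigenvectorUnitary.2
        simpa [Matrix.star_eq_conjTranspose] using this
      · have := hS.spectral_theorem
        rw [Unitary.conjStarAlgAut_apply] at this
        simpa [Matrix.star_eq_conjTranspose, Function.comp_def] using this
    have key : ∀ E F : n → ℝ, U * Matrix.diagonal E * Uᵀ * (U * Matrix.diagonal F * Uᵀ) =
        U * Matrix.diagonal (fun i => E i * F i) * Uᵀ := by
      intro E F
      calc _ = U * Matrix.diagonal E * (Uᵀ * U) * Matrix.diagonal F * Uᵀ := by
            simp only [Matrix.mul_assoc]
        _ = _ := by
            rw [hU, Matrix.mul_one, Matrix.mul_assoc U, Matrix.diagonal_mul_diagonal]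
    -- Since 0⁻¹ = 0, this is the pseudo-inverse even when some eigenvalues vanish.
    refine ⟨U * Matrix.diagonal (fun i => (D i)⁻¹) * Uᵀ, ?_, ?_⟩
    · rw [hD, key, key]
      simp [mul_inv_mul_cancel]
    · rw [hD, key]
      simp [Matrix.transpose_mul, Matrix.mul_assoc]
  refine ⟨H * Aᵀ, ?_, by simpa only [Matrix.mul_assoc] using hsymm⟩
  -- The defect A g A - A lies in the range of A and is killed by Aᵀ, so it is orthogonal to itself.
  rw [← sub_eq_zero]
  refine matInner_self_eq_zero ?_
  have h0 : Aᵀ * (A * (H * Aᵀ) * A - A) = 0 := by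
    rw [Matrix.mul_sub, sub_eq_zero]
    simpa only [Matrix.mul_assoc] using hH
  have h1 : A * (H * Aᵀ) * A - A = A * (H * Aᵀ * A - 1) := by
    simp only [Matrix.mul_sub, Matrix.mul_one, Matrix.mul_assoc]
  nth_rewrite 1 [h1]
  rw [matInner_eq_trace, Matrix.transpose_mul, Matrix.mul_assoc, h0, Matrix.mul_zero,
    Matrix.trace_zero]

lemma trace_mul_transpose_symm {S : Matrix n n ℝ} (hS : S.IsSymm) (U : Matrix n n ℝ) :
    (S * Uᵀ).trace = (S * U).trace := by
  rw [← Matrix.trace_transpose, Matrix.transpose_mul, Matrix.transpose_transpose, hS.eq,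
    Matrix.trace_mul_comm]

/-- A normal vector at `A` to the orbit `{A U}` of the orthogonal group is orthogonal to
`A - A U` up to second order. -/
lemma exists_abs_matInner_le_of_isSymm [DecidableEq n] {A N : Matrix m n ℝ} (h : (Nᵀ * A).IsSymm) :
    ∃ C : ℝ, 0 ≤ C ∧ ∀ U ∈ Matrix.orthogonalGroup n ℝ,
      |matInner (A - A * U) N| ≤ C * matInner (A - A * U) (A - A * U) := by
  obtain ⟨g, hg, -⟩ := exists_generalized_inverse A
  have hAN : Aᵀ * N = Nᵀ * A := by
    have := h.eq
    rwa [Matrix.transpose_mul, Matrix.transpose_transpose] at this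
  -- Symmetry lets N g stand for N between Aᵀ and A; this turns ⟨D, N⟩ into a quadratic form in D.
  have hB : Aᵀ * (N * g) * A = Nᵀ * A := by
    rw [← Matrix.mul_assoc, hAN, Matrix.mul_assoc, Matrix.mul_assoc, ← Matrix.mul_assoc A, hg]
  refine ⟨√(matInner (N * g) (N * g)), Real.sqrt_nonneg _, fun U hU => ?_⟩
  have hUU : U * Uᵀ = 1 := by
    simpa [Matrix.star_eq_conjTranspose] using (Matrix.mem_orthogonalGroup_iff n ℝ).1 hU
  set D := A - A * U with hD
  have hD' : D = A * (1 - U) := by rw [hD, Matrix.mul_sub, Matrix.mul_one]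
  have e1 : matInner D N = ((Nᵀ * A) * (1 - U)).trace := by
    rw [matInner_comm, matInner_eq_trace, hD', Matrix.mul_assoc]
  -- Orthogonality gives (1 - U)(1 - U)ᵀ = (1 - U) + (1 - U)ᵀ, and both summands have the same trace
  -- against the symmetric matrix NᵀA. The constant ‖N g‖ chosen above is twice what this identity
  -- requires.
  have e2 : matInner D ((N * g) * D) = 2 * matInner D N := by
    have : Dᵀ * (N * g * D) = (1 - U)ᵀ * (Nᵀ * A) * (1 - U) := by
      rw [← hB, hD', Matrix.transpose_mul]
      simp only [Matrix.mul_assoc]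
    rw [e1, matInner_eq_trace, this, Matrix.trace_mul_comm, ← Matrix.mul_assoc,
      Matrix.trace_mul_comm]
    have : (1 - U) * (1 - U)ᵀ = (1 - U) + (1 - U)ᵀ := by
      simp only [Matrix.transpose_sub, Matrix.transpose_one, Matrix.sub_mul, Matrix.mul_sub, hUU,
        Matrix.mul_one, Matrix.one_mul]
      abel
    rw [this, Matrix.mul_add, Matrix.trace_add, trace_mul_transpose_symm h]
    ring
  have e3 := abs_matInner_le D (N * g * D)
  have e4 : √(matInner (N * g * D) (N * g * D)) ≤ √(matInner (N * g) (N * g)) * √(matInner D D) := by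
    rw [← Real.sqrt_mul (matInner_self_nonneg _)]
    exact Real.sqrt_le_sqrt (matInner_mul_self_le _ _)
  have e5 : √(matInner D D) * √(matInner D D) = matInner D D :=
    Real.mul_self_sqrt (matInner_self_nonneg _)
  rw [e2, abs_mul, abs_two] at e3
  have e6 := mul_le_mul_of_nonneg_left e4 (Real.sqrt_nonneg (matInner D D))
  have e7 := abs_nonneg (matInner D N)
  calc |matInner D N| ≤ √(matInner D D) * (√(matInner (N * g) (N * g)) * √(matInner D D)) := by
        linarith
    _ = √(matInner (N * g) (N * g)) * (√(matInner D D) * √(matInner D D)) := by ring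
    _ = _ := by rw [e5]

end FrobeniusInner

/-! ### Trace maximizers over the orthogonal group -/

lemma real_dotProduct_self_nonneg {n : Type*} [Fintype n] (v : n → ℝ) : 0 ≤ v ⬝ᵥ v :=
  Finset.sum_nonneg fun _ _ => mul_self_nonneg _

lemma trace_vecMulVec_mul {n : Type*} [Fintype n] (v w : n → ℝ) (N : Matrix n n ℝ) :
    (Matrix.vecMulVec v w * N).trace = w ⬝ᵥ (N *ᵥ v) := by
  simp only [Matrix.trace, Matrix.diag, Matrix.mul_apply, Matrix.vecMulVec_apply, dotProduct,
    Matrix.mulVec, Finset.mul_sum]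
  rw [Finset.sum_comm]
  exact Finset.sum_congr rfl fun _ _ => Finset.sum_congr rfl fun _ _ => by ring

section TraceMax
variable {n : Type*} [Fintype n] [DecidableEq n]

/-- The reflection along v. Reflections and products of two of them are the only competitors needed
for the optimality conditions below. -/
lemma householder_mem (v : n → ℝ) (hv : v ⬝ᵥ v ≠ 0) :
    (1 - (2 / (v ⬝ᵥ v)) • Matrix.vecMulVec v v) ∈ Matrix.orthogonalGroup n ℝ := by
  rw [Matrix.mem_orthogonalGroup_iff]
  have h : Matrix.vecMulVec v v * Matrix.vecMulVec v v = (v ⬝ᵥ v) • Matrix.vecMulVec v v := by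
    rw [Matrix.vecMulVec_mul_vecMulVec]
    ext i j
    simp [Matrix.vecMulVec_apply]
    try ring
  have ht : (Matrix.vecMulVec v v)ᵀ = Matrix.vecMulVec v v := by
    ext i j
    simp [Matrix.vecMulVec_apply, mul_comm]
  rw [Matrix.transpose_sub, Matrix.transpose_one, Matrix.transpose_smul, ht]
  simp only [Matrix.sub_mul, Matrix.mul_sub, Matrix.one_mul, Matrix.mul_one, Matrix.smul_mul,
    Matrix.mul_smul, h, smul_smul]
  rw [div_mul_cancel₀ _ hv, two_smul, ← sub_sub, sub_self, zero_sub, smul_neg]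
  abel

/-- The reflection along v changes the trace by -2 (v ⬝ Nv) / (v ⬝ v), which cannot be positive. -/
lemma dotProduct_mulVec_nonneg_of_trace_le {N : Matrix n n ℝ}
    (h : ∀ U ∈ Matrix.orthogonalGroup n ℝ, (U * N).trace ≤ N.trace) (v : n → ℝ) :
    0 ≤ v ⬝ᵥ (N *ᵥ v) := by
  by_cases hv : v ⬝ᵥ v = 0
  · rw [dotProduct_self_eq_zero.1 hv]
    simp
  have h1 := h _ (householder_mem v hv)
  rw [Matrix.sub_mul, Matrix.one_mul, Matrix.trace_sub, Matrix.smul_mul, Matrix.trace_smul,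
    trace_vecMulVec_mul, smul_eq_mul] at h1
  have hpos : 0 < v ⬝ᵥ v := lt_of_le_of_ne (real_dotProduct_self_nonneg v) (Ne.symm hv)
  have : 0 ≤ 2 / (v ⬝ᵥ v) * v ⬝ᵥ (N *ᵥ v) := by linarith
  exact nonneg_of_mul_nonneg_right this (by positivity)

/-- First order optimality: a matrix whose trace is maximal in its left orbit under the orthogonal
group is symmetric. -/
lemma isSymm_of_trace_le {N : Matrix n n ℝ}
    (h : ∀ U ∈ Matrix.orthogonalGroup n ℝ, (U * N).trace ≤ N.trace) : N.IsSymm := by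
  have key : ∀ v w : n → ℝ, v ⬝ᵥ v = 1 → w ⬝ᵥ w = 1 → v ⬝ᵥ w = 0 →
      v ⬝ᵥ (N *ᵥ w) ≤ w ⬝ᵥ (N *ᵥ v) := by
    intro v w hv hw hvw
    have hwv : w ⬝ᵥ v = 0 := by rw [dotProduct_comm, hvw]
    by_contra hlt
    push Not at hlt
    set x := v ⬝ᵥ (N *ᵥ w) - w ⬝ᵥ (N *ᵥ v) with hx
    set y := v ⬝ᵥ (N *ᵥ v) + w ⬝ᵥ (N *ᵥ w) with hy
    have hx0 : 0 < x := by linarith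
    -- The product of the reflections along v and v + s w is a rotation in the plane of v and w, by
    -- an angle of first order in s. The trace inequality for it, cleared of the denominator 1 + s²,
    -- is this one.
    have main : ∀ s : ℝ, 0 ≤ s * x + s ^ 2 * y := by
      intro s
      have hz : (v + s • w) ⬝ᵥ (v + s • w) = 1 + s ^ 2 := by
        simp [add_dotProduct, dotProduct_add, hv, hw, hvw, hwv]
        ring
      have h1 := h _ (mul_mem (householder_mem v (by rw [hv]; norm_num))
        (householder_mem (v + s • w) (by rw [hz]; positivity)))
      have e : (Matrix.vecMulVec v v * Matrix.vecMulVec (v + s • w) (v + s • w)) =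
          Matrix.vecMulVec v (v + s • w) := by
        rw [Matrix.vecMulVec_mul_vecMulVec]
        simp [dotProduct_add, hv, hvw]
      simp only [hz, hv, Matrix.sub_mul, Matrix.mul_sub, Matrix.one_mul, Matrix.mul_one,
        Matrix.smul_mul, Matrix.mul_smul, e] at h1
      simp only [Matrix.trace_sub,
        Matrix.trace_smul, trace_vecMulVec_mul, smul_eq_mul, Matrix.mulVec_add, Matrix.mulVec_smul,
        add_dotProduct, dotProduct_add, smul_dotProduct, dotProduct_smul] at h1
      have hs : (0:ℝ) < 1 + s ^ 2 := by positivity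
      have h2 : 0 ≤ (1 + s ^ 2) * (2 / (1 + s ^ 2)) * (v ⬝ᵥ (N *ᵥ v) + s * (v ⬝ᵥ (N *ᵥ w)) +
          s * (w ⬝ᵥ (N *ᵥ v) + s * (w ⬝ᵥ (N *ᵥ w)))) + (1 + s ^ 2) * 2 * (v ⬝ᵥ (N *ᵥ v)) -
          2 * ((1 + s ^ 2) * (2 / (1 + s ^ 2))) * (v ⬝ᵥ (N *ᵥ v) + s * (w ⬝ᵥ (N *ᵥ v))) := by
        nlinarith [mul_nonneg hs.le (sub_nonneg.2 h1)]
      rw [mul_div_cancel₀ _ hs.ne'] at h2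
      rw [hx, hy]
      nlinarith
    -- A negative s contradicts `main`: s = -1 if y ≤ 0, and otherwise the minimizer s = -x / (2y),
    -- with value -x² / (4y).
    rcases le_or_gt y 0 with hy0 | hy0
    · nlinarith [main (-1)]
    · have h1 := main (-(x / (2 * y)))
      have e1 : (-(x / (2 * y))) ^ 2 * y = x / (2 * y) * x / 2 := by field_simp
      rw [e1] at h1
      have : 0 < x / (2 * y) * x := by positivity
      linarith
  ext i j
  rw [Matrix.transpose_apply]
  by_cases hij : i = j
  · rw [hij]
  have e : ∀ a b : n, (Pi.single a 1 : n → ℝ) ⬝ᵥ (N *ᵥ Pi.single b 1) = N a b := by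
    intro a b
    simp
  have h1 := key (Pi.single i 1) (Pi.single j 1) (by simp) (by simp) (by simp [hij])
  have h2 := key (Pi.single j 1) (Pi.single i 1) (by simp) (by simp) (by simp [Ne.symm hij])
  rw [e, e] at h1 h2
  exact le_antisymm h2 h1

end TraceMax

/-! ### Block columns and the action of `𝐎` -/

section Blocks

variable {T d : ℕ}

/-- The block column `(A_{s,t})ₛ`. -/
def colBlock (A : BMat T d) (t : Fin T) : Matrix (Fin d × Fin T) (Fin d) ℝ :=
  A.submatrix id (fun i => (i, t))

/-- 𝐎 acts from the right on each block column separately, so this splitting decouples optimization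
over 𝐎 into one problem per time. -/
lemma matInner_eq_sum_colBlock (A B : BMat T d) :
    matInner A B = ∑ t, matInner (colBlock A t) (colBlock B t) := by
  change _ = ∑ t, ∑ p, ∑ i, A p (i, t) * B p (i, t)
  rw [Finset.sum_comm]
  refine Finset.sum_congr rfl fun p _ => ?_
  rw [Fintype.sum_prod_type]
  exact Finset.sum_comm

lemma colBlock_mul_blockDiagonal (A : BMat T d) (U : Fin T → Matrix (Fin d) (Fin d) ℝ)
    (t : Fin T) : colBlock (A * Matrix.blockDiagonal U) t = colBlock A t * U t := by
  ext p i
  simp only [colBlock, Matrix.submatrix_apply, id, Matrix.mul_apply, Fintype.sum_prod_type,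
    Matrix.blockDiagonal_apply]
  refine Finset.sum_congr rfl fun j _ => ?_
  rw [Finset.sum_eq_single t]
  · simp
  · intro s _ hs
    simp [hs]
  · simp

lemma block_transpose_mul (A B : BMat T d) (t s : Fin T) :
    block (Aᵀ * B) t s = (colBlock A t)ᵀ * colBlock B s := by
  ext i j
  simp [block, colBlock, Matrix.mul_apply]

lemma colBlock_sub (A B : BMat T d) (t : Fin T) :
    colBlock (A - B) t = colBlock A t - colBlock B t := rfl

lemma frob_sq (A : BMat T d) : frob A ^ 2 = matInner A A := by
  refine (Real.sq_sqrt ?_).trans ?_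
  · exact Finset.sum_nonneg fun _ _ => Finset.sum_nonneg fun _ _ => sq_nonneg _
  · simp [matInner, sq]

lemma frob_eq_sqrt (A : BMat T d) : frob A = √(matInner A A) := by
  rw [← frob_sq, Real.sqrt_sq (frob_nonneg A)]

lemma norm_matVec_eq_frob (A : BMat T d) : ‖matVec A‖ = frob A := by
  rw [norm_matVec, frob_eq_sqrt]

lemma frob_smul (c : ℝ) (A : BMat T d) : frob (c • A) = |c| * frob A := by
  rw [frob_eq_sqrt, frob_eq_sqrt, matInner_smul_left, matInner_smul_right, ← mul_assoc,
    Real.sqrt_mul (mul_self_nonneg c), Real.sqrt_mul_self_eq_abs]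

lemma frob_sub_comm (A B : BMat T d) : frob (A - B) = frob (B - A) := by
  rw [← frob_neg, neg_sub]

lemma frob_sub_sq (A B : BMat T d) :
    frob (A - B) ^ 2 = frob A ^ 2 + frob B ^ 2 - 2 * matInner A B := by
  simp only [frob_sq, matInner_sub_left, matInner_sub_right]
  rw [matInner_comm B A]
  ring

lemma frob_add_sq (A B : BMat T d) :
    frob (A + B) ^ 2 = frob A ^ 2 + frob B ^ 2 + 2 * matInner A B := by
  simp only [frob_sq, matInner_add_left, matInner_add_right]
  rw [matInner_comm B A]
  ring

lemma bO_transpose_mul {O : BMat T d} (hO : O ∈ bO T d) : Oᵀ * O = 1 := by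
  simpa using bO_mul_transpose (bO_transpose hO)

lemma mul_mul_transpose_bO (A : BMat T d) {O : BMat T d} (hO : O ∈ bO T d) : A * O * Oᵀ = A := by
  rw [Matrix.mul_assoc, bO_mul_transpose hO, Matrix.mul_one]

lemma mul_transpose_mul_bO (A : BMat T d) {O : BMat T d} (hO : O ∈ bO T d) : A * Oᵀ * O = A := by
  rw [Matrix.mul_assoc, bO_transpose_mul hO, Matrix.mul_one]

lemma matInner_mul_bO (A B : BMat T d) {O : BMat T d} (hO : O ∈ bO T d) :
    matInner (A * O) (B * O) = matInner A B := by
  rw [matInner_eq_trace, Matrix.transpose_mul, Matrix.mul_assoc, Matrix.trace_mul_comm,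
    Matrix.mul_assoc, mul_mul_transpose_bO B hO, matInner_eq_trace]

lemma matInner_mul_bO_right (A B : BMat T d) {O : BMat T d} (hO : O ∈ bO T d) :
    matInner A (B * O) = matInner (A * Oᵀ) B := by
  rw [← matInner_mul_bO (A * Oᵀ) B hO, mul_transpose_mul_bO A hO]

lemma frob_sub_mul_bO (A B : BMat T d) {O : BMat T d} (hO : O ∈ bO T d) :
    frob (A - B * O) = frob (A * Oᵀ - B) := by
  rw [← frob_mul (A * Oᵀ - B) hO, Matrix.sub_mul, mul_transpose_mul_bO A hO]

lemma continuous_frob : Continuous (frob : BMat T d → ℝ) := by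
  unfold frob
  fun_prop

lemma mul_mem_bL {A O : BMat T d} (hA : A ∈ bL T d) (hO : O ∈ bO T d) : A * O ∈ bL T d := by
  obtain ⟨U, -, rfl⟩ := hO
  intro t s hts
  have h : block A t s = 0 := hA t s hts
  ext i j
  have h1 := congrFun (congrFun (colBlock_mul_blockDiagonal A U s) (i, t)) j
  simp only [colBlock, Matrix.submatrix_apply, id] at h1
  simp only [block, Matrix.submatrix_apply, Matrix.zero_apply, h1, Matrix.mul_apply]
  refine Finset.sum_eq_zero fun k _ => ?_
  have h2 := congrFun (congrFun h i) k
  simp only [block, Matrix.submatrix_apply, Matrix.zero_apply] at h2 ⊢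
  exact mul_eq_zero_of_left h2 _

lemma add_mem_bL {A B : BMat T d} (hA : A ∈ bL T d) (hB : B ∈ bL T d) : A + B ∈ bL T d := by
  intro t s hts
  have h1 : block A t s = 0 := hA t s hts
  have h2 : block B t s = 0 := hB t s hts
  change block A t s + block B t s = 0
  rw [h1, h2, add_zero]

lemma smul_mem_bL (c : ℝ) {A : BMat T d} (hA : A ∈ bL T d) : c • A ∈ bL T d := by
  intro t s hts
  have h1 : block A t s = 0 := hA t s hts
  change c • block A t s = 0
  rw [h1, smul_zero]

lemma sub_mem_bL {A B : BMat T d} (hA : A ∈ bL T d) (hB : B ∈ bL T d) : A - B ∈ bL T d := by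
  rw [sub_eq_add_neg, ← neg_one_smul ℝ B]
  exact add_mem_bL hA (smul_mem_bL _ hB)

/-! ### Compactness of 𝐎 and optimal rotations -/

lemma isClosed_bL : IsClosed (bL T d) := by
  have : bL T d = ⋂ t, ⋂ s, ⋂ (_ : t < s), {A | block A t s = 0} := by
    ext A
    simp [bL]
  rw [this]
  refine isClosed_iInter fun t => isClosed_iInter fun s => isClosed_iInter fun _ => ?_
  exact isClosed_eq (continuous_id.matrix_submatrix _ _) continuous_const

lemma isCompact_bO : IsCompact (bO T d) := by
  -- Membership is expressed by closed conditions: O Oᵀ = 1 and vanishing off-diagonal blocks.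
  -- Boundedness comes from the rows having norm one.
  have h : bO T d = {O | O * Oᵀ = 1} ∩ Set.range (Matrix.blockDiagonal : (Fin T → _) → BMat T d) := by
    ext O
    constructor
    · intro hO
      refine ⟨bO_mul_transpose hO, ?_⟩
      obtain ⟨U, -, rfl⟩ := hO
      exact ⟨U, rfl⟩
    · rintro ⟨h, U, rfl⟩
      refine ⟨U, fun t => ?_, rfl⟩
      have h1 : Matrix.blockDiagonal U * (Matrix.blockDiagonal U)ᵀ = 1 := h
      rw [Matrix.blockDiagonal_transpose, ← Matrix.blockDiagonal_mul,
        ← Matrix.blockDiagonal_one] at h1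
      rw [Matrix.mem_orthogonalGroup_iff]
      exact congrFun (Matrix.blockDiagonal_injective h1) t
  have hr : Set.range (Matrix.blockDiagonal : (Fin T → _) → BMat T d) =
      {A | ∀ i j t s, t ≠ s → A (i, t) (j, s) = 0} := by
    ext A
    constructor
    · rintro ⟨U, rfl⟩ i j t s hts
      exact Matrix.blockDiagonal_apply_ne U i j hts
    · intro hA
      refine ⟨fun t => block A t t, ?_⟩
      ext ⟨i, t⟩ ⟨j, s⟩
      rw [Matrix.blockDiagonal_apply]
      split_ifs with hts
      · obtain rfl : t = s := hts
        rfl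
      · exact (hA i j t s hts).symm
  have hclosed : IsClosed (bO T d) := by
    rw [h, hr]
    refine IsClosed.inter (isClosed_eq (by fun_prop) continuous_const) ?_
    simp only [Set.ofPred_forall]
    refine isClosed_iInter fun i => isClosed_iInter fun j => isClosed_iInter fun t =>
      isClosed_iInter fun s => isClosed_iInter fun _ => isClosed_eq ?_ continuous_const
    exact continuous_id.matrix_elem _ _
  refine IsCompact.of_isClosed_subset
    (isCompact_univ_pi fun _ => isCompact_univ_pi fun _ => isCompact_Icc (a := (-1 : ℝ)) (b := 1))
    hclosed ?_
  intro O hO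
  refine Set.mem_univ_pi.2 fun p => Set.mem_univ_pi.2 fun q => ?_
  refine Set.mem_Icc.2 (abs_le.1 ?_)
  have h1 := congrFun (congrFun (bO_mul_transpose hO) p) p
  rw [Matrix.mul_apply, Matrix.one_apply_eq] at h1
  have h2 : O p q * O p q ≤ ∑ r, O p r * Oᵀ r p :=
    Finset.single_le_sum (f := fun r => O p r * Oᵀ r p) (fun r _ => mul_self_nonneg (O p r))
      (Finset.mem_univ q)
  rw [h1] at h2
  exact abs_le_one_iff_mul_self_le_one.2 h2

lemma exists_mem_Ostar (L M : BMat T d) : ∃ O, O ∈ Ostar L M := by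
  obtain ⟨O, hO, hmin⟩ := isCompact_bO.exists_isMinOn ⟨1, bO_one T d⟩
    (f := fun O => frob (L - M * O))
    (continuous_frob.comp (continuous_const.sub (continuous_const.mul continuous_id))).continuousOn
  exact ⟨O, hO, fun O' hO' => hmin hO'⟩

lemma single_mem_bO (t : Fin T) {U : Matrix (Fin d) (Fin d) ℝ}
    (hU : U ∈ Matrix.orthogonalGroup (Fin d) ℝ) :
    Matrix.blockDiagonal (Function.update (fun _ => 1) t U) ∈ bO T d := by
  refine ⟨_, fun s => ?_, rfl⟩
  by_cases hs : s = t
  · subst hs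
    simpa using hU
  · simp [hs]

/-- ‖MQ‖ does not depend on Q, so minimizing the distance amounts to maximizing the inner product.
-/
lemma matInner_le_of_mem_Ostar {L M O Q : BMat T d} (hO : O ∈ Ostar L M) (hQ : Q ∈ bO T d) :
    matInner L (M * Q) ≤ matInner L (M * O) := by
  have h := pow_le_pow_left₀ (frob_nonneg _) (hO.2 Q hQ) 2
  rw [frob_sub_sq, frob_sub_sq, frob_mul M hQ, frob_mul M hO.1] at h
  linarith

/-- Optimality conditions of first and second order for the minimizers in `𝐎*(L, M)`. -/
lemma isSymm_and_nonneg_of_mem_Ostar {L M O : BMat T d} (hO : O ∈ Ostar L M) (t : Fin T) :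
    (block ((M * O)ᵀ * L) t t).IsSymm ∧
      ∀ v, 0 ≤ v ⬝ᵥ (block ((M * O)ᵀ * L) t t *ᵥ v) := by
  have key : ∀ U ∈ Matrix.orthogonalGroup (Fin d) ℝ,
      (U * block ((M * O)ᵀ * L) t t).trace ≤ (block ((M * O)ᵀ * L) t t).trace := by
    intro U hU
    have hUt : Uᵀ ∈ Matrix.orthogonalGroup (Fin d) ℝ := by
      simpa [Matrix.star_eq_conjTranspose] using Unitary.star_mem hU
    -- Only block t of O is perturbed, so all other block columns cancel from the comparison.
    have h := matInner_le_of_mem_Ostar hO (bO_mul hO.1 (single_mem_bO t hUt))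
    rw [← Matrix.mul_assoc, matInner_eq_sum_colBlock, matInner_eq_sum_colBlock,
      ← Finset.add_sum_erase _ _ (Finset.mem_univ t), ← Finset.add_sum_erase _ _ (Finset.mem_univ t),
      Finset.sum_congr rfl (g := fun s => matInner (colBlock L s) (colBlock (M * O) s)) ?_] at h
    · have h1 := le_of_add_le_add_right h
      rw [colBlock_mul_blockDiagonal, Function.update_self, matInner_comm, matInner_eq_trace,
        matInner_comm, matInner_eq_trace, Matrix.transpose_mul, Matrix.transpose_transpose,
        Matrix.mul_assoc] at h1
      rwa [block_transpose_mul]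
    · intro s hs
      rw [colBlock_mul_blockDiagonal, Function.update_of_ne (Finset.ne_of_mem_erase hs),
        Matrix.mul_one]
  exact ⟨isSymm_of_trace_le key, dotProduct_mulVec_nonneg_of_trace_le key⟩

/-- A vector of `𝓥(L)` is orthogonal to the displacements along the orbit of `L` up to second
order. -/
lemma exists_abs_matInner_le_of_mem_calV {L N : BMat T d} (hN : N ∈ calV L) :
    ∃ C : ℝ, 0 ≤ C ∧ ∀ O ∈ bO T d, |matInner (L - L * O) N| ≤ C * frob (L - L * O) ^ 2 := by
  have h : ∀ t, ∃ C : ℝ, 0 ≤ C ∧ ∀ U ∈ Matrix.orthogonalGroup (Fin d) ℝ,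
      |matInner (colBlock L t - colBlock L t * U) (colBlock N t)| ≤
        C * matInner (colBlock L t - colBlock L t * U) (colBlock L t - colBlock L t * U) := by
    intro t
    have := hN.2 t
    rw [block_transpose_mul] at this
    exact exists_abs_matInner_le_of_isSymm this
  choose C hC0 hC using h
  refine ⟨∑ t, C t, Finset.sum_nonneg fun t _ => hC0 t, ?_⟩
  rintro _ ⟨U, hU, rfl⟩
  rw [frob_sq, matInner_eq_sum_colBlock, matInner_eq_sum_colBlock, Finset.mul_sum]
  refine (Finset.abs_sum_le_sum_abs _ _).trans (Finset.sum_le_sum fun t _ => ?_)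
  rw [colBlock_sub, colBlock_mul_blockDiagonal]
  refine (hC t _ (hU t)).trans (mul_le_mul_of_nonneg_right ?_ (matInner_self_nonneg _))
  exact Finset.single_le_sum (f := C) (fun t _ => hC0 t) (Finset.mem_univ t)

end Blocks

/-! ### The quotient metric on `𝐋/𝐎` -/

section OrbitDistance

variable {T d : ℕ}

/-- The distance between the `𝐎`-orbits of two matrices. -/
def orbitDist (A B : BMat T d) : ℝ := ⨅ O : bO T d, frob (A - B * (O : BMat T d))

lemma orbitDist_le {O : BMat T d} (hO : O ∈ bO T d) (A B : BMat T d) :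
    orbitDist A B ≤ frob (A - B * O) :=
  ciInf_le (f := fun O : bO T d => frob (A - B * (O : BMat T d)))
    ⟨0, by rintro _ ⟨O, rfl⟩; exact frob_nonneg _⟩ ⟨O, hO⟩

lemma le_orbitDist {A B : BMat T d} {c : ℝ} (h : ∀ O ∈ bO T d, c ≤ frob (A - B * O)) :
    c ≤ orbitDist A B :=
  haveI : Nonempty (bO T d) := ⟨⟨1, bO_one T d⟩⟩
  le_ciInf fun O => h O O.2

lemma orbitDist_eq {A B O : BMat T d} (hO : O ∈ Ostar A B) : orbitDist A B = frob (A - B * O) :=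
  le_antisymm (orbitDist_le hO.1 A B) (le_orbitDist hO.2)

lemma orbitDist_nonneg (A B : BMat T d) : 0 ≤ orbitDist A B :=
  le_orbitDist fun _ _ => frob_nonneg _

lemma orbitDist_le_frob (A B : BMat T d) : orbitDist A B ≤ frob (A - B) := by
  simpa using orbitDist_le (bO_one T d) A B

lemma orbitDist_self (A : BMat T d) : orbitDist A A = 0 :=
  le_antisymm (by simpa [frob_zero] using orbitDist_le_frob A A) (orbitDist_nonneg A A)

lemma orbitDist_comm (A B : BMat T d) : orbitDist A B = orbitDist B A := by
  have key : ∀ A B : BMat T d, orbitDist A B ≤ orbitDist B A := by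
    intro A B
    refine le_orbitDist fun O hO => ?_
    rw [frob_sub_mul_bO B A hO, frob_sub_comm]
    exact orbitDist_le (bO_transpose hO) A B
  exact le_antisymm (key A B) (key B A)

/-- Since 𝐎 acts by isometries, the product of the optimal rotations for (B, C) and (A, B) is a
competitor for (A, C). -/
lemma orbitDist_triangle (A B C : BMat T d) :
    orbitDist A C ≤ orbitDist A B + orbitDist B C := by
  obtain ⟨O, hO⟩ := exists_mem_Ostar A B
  obtain ⟨Q, hQ⟩ := exists_mem_Ostar B C
  rw [orbitDist_eq hO, orbitDist_eq hQ]
  refine (orbitDist_le (bO_mul hQ.1 hO.1) A C).trans ?_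
  rw [← frob_mul (B - C * Q) hO.1]
  refine le_trans (le_of_eq ?_) (frob_add_le _ _)
  rw [Matrix.sub_mul, Matrix.mul_assoc]
  congr 1
  abel

lemma orbitDist_mul_right (A B : BMat T d) {O : BMat T d} (hO : O ∈ bO T d) :
    orbitDist A (B * O) = orbitDist A B := by
  refine le_antisymm (le_orbitDist fun Q hQ => ?_) (le_orbitDist fun Q hQ => ?_)
  · have := orbitDist_le (bO_mul (bO_transpose hO) hQ) A (B * O)
    rwa [← Matrix.mul_assoc, mul_mul_transpose_bO B hO] at this
  · have := orbitDist_le (bO_mul hO hQ) A B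
    rwa [← Matrix.mul_assoc] at this

lemma orbitDist_mul_left (A B : BMat T d) {O : BMat T d} (hO : O ∈ bO T d) :
    orbitDist (A * O) B = orbitDist A B := by
  rw [orbitDist_comm, orbitDist_mul_right B A hO, orbitDist_comm]

lemma exists_eq_mul_of_orbitDist_eq_zero {A B : BMat T d} (h : orbitDist A B = 0) :
    ∃ O ∈ bO T d, A = B * O := by
  obtain ⟨O, hO⟩ := exists_mem_Ostar A B
  rw [orbitDist_eq hO] at h
  exact ⟨O, hO.1, sub_eq_zero.1 (frob_eq_zero h)⟩

/-- The orbit metric on `𝐋/𝐎`. -/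
@[reducible]
def orbitMetricSpace (T d : ℕ) : MetricSpace (ABWSpace T d) where
  dist := Quotient.lift₂ (fun A B : bL T d => orbitDist A.1 B.1) (by
    rintro A B A' B' ⟨O, hO, h⟩ ⟨Q, hQ, h'⟩
    rw [h, h', orbitDist_mul_left _ _ hO, orbitDist_mul_right _ _ hQ])
  dist_self := by
    rintro ⟨A⟩
    exact orbitDist_self A.1
  dist_comm := by
    rintro ⟨A⟩ ⟨B⟩
    exact orbitDist_comm A.1 B.1
  dist_triangle := by
    rintro ⟨A⟩ ⟨B⟩ ⟨C⟩
    exact orbitDist_triangle A.1 B.1 C.1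
  eq_of_dist_eq_zero := by
    rintro ⟨A⟩ ⟨B⟩ h
    exact Quotient.sound (exists_eq_mul_of_orbitDist_eq_zero h)

attribute [local instance] orbitMetricSpace

/-! ### Geodesics from `[L]` as normal rays -/

lemma Geod.dist_start {S : Type*} [MetricSpace S] {x : S} (γ : Geod x) (u : unitInterval) :
    dist x (γ.toFun u) = u * dist (γ.toFun 0) (γ.toFun 1) := by
  have h := γ.const_speed 0 u
  rw [Set.Icc.coe_zero, zero_sub, abs_neg, abs_of_nonneg u.2.1] at h
  rw [← h, congrArg (dist · (γ.toFun u)) γ.start]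

lemma dist_cls (A B : bL T d) : dist (cls A) (cls B) = orbitDist A.1 B.1 := rfl

lemma cls_surjective : Function.Surjective (cls : bL T d → ABWSpace T d) := Quotient.mk_surjective

/-- The curve `u ↦ L + uV` in `𝐋`. -/
def ray (L : bL T d) (V : bL T d) (u : ℝ) : bL T d :=
  ⟨L.1 + u • V.1, add_mem_bL L.2 (smul_mem_bL u V.2)⟩

lemma ray_zero (L V : bL T d) : ray L V 0 = L := by
  ext1
  simp [ray]

lemma frob_ray_sub (L V W : bL T d) (u v : ℝ) :
    frob ((ray L V u).1 - (ray L W v).1) = frob (u • V.1 - v • W.1) := by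
  simp [ray]

lemma abs_le_frob (A : BMat T d) (p q : Fin d × Fin T) : |A p q| ≤ frob A := by
  have := PiLp.norm_apply_le (matVec A) (p, q)
  rw [norm_matVec_eq_frob] at this
  simpa [matVec] using this

lemma isCompact_frob_eq {S : Set (BMat T d)} (hS : IsClosed S) (R : ℝ) :
    IsCompact {A | A ∈ S ∧ frob A = R} := by
  refine IsCompact.of_isClosed_subset
    (isCompact_univ_pi fun _ => isCompact_univ_pi fun _ => isCompact_Icc (a := -R) (b := R))
    (hS.inter (isClosed_eq continuous_frob continuous_const)) ?_
  rintro A ⟨-, hA⟩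
  refine Set.mem_univ_pi.2 fun p => Set.mem_univ_pi.2 fun q => Set.mem_Icc.2 (abs_le.1 ?_)
  rw [← hA]
  exact abs_le_frob A p q

/-- Equality in the triangle inequality for the Frobenius norm. -/
lemma smul_eq_smul_of_le_frob_add {X Y : BMat T d} {a b D : ℝ} (ha : 0 ≤ a) (hb : 0 ≤ b)
    (hD : 0 ≤ D) (hX : frob X = a * D) (hY : frob Y = b * D) (h : (a + b) * D ≤ frob (X + Y)) :
    a • Y = b • X := by
  have h1 := pow_le_pow_left₀ (by positivity) h 2
  rw [frob_add_sq, hX, hY] at h1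
  have h2 : a * b * D ^ 2 ≤ matInner X Y := by nlinarith
  -- The square expands to 2ab (abD² - ⟨X, Y⟩).
  have h3 : frob (a • Y - b • X) ^ 2 ≤ 0 := by
    rw [frob_sub_sq, frob_smul, frob_smul, matInner_smul_left, matInner_smul_right, matInner_comm,
      hX, hY, mul_pow, mul_pow, mul_pow, mul_pow, sq_abs, sq_abs]
    nlinarith [mul_le_mul_of_nonneg_left h2 (mul_nonneg ha hb)]
  have h4 : frob (a • Y - b • X) = 0 := by
    have := frob_nonneg (a • Y - b • X)
    nlinarith
  exact sub_eq_zero.1 (frob_eq_zero h4)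

/-- Every geodesic from `[L]` can be lifted, past any positive time, to a ray from `L`. -/
lemma Geod.exists_ray_of_pos {L : bL T d} (γ : Geod (cls L)) {u : unitInterval} (hu : 0 < u) :
    ∃ V : bL T d, frob V.1 = dist (γ.toFun 0) (γ.toFun 1) ∧
      ∀ v, u ≤ v → γ.toFun v = cls (ray L V v) := by
  set D := dist (γ.toFun 0) (γ.toFun 1) with hD
  have hD0 : 0 ≤ D := dist_nonneg
  have hu' : (0 : ℝ) < u := hu
  obtain ⟨R, hR⟩ := cls_surjective (γ.toFun u)
  obtain ⟨O, hO⟩ := exists_mem_Ostar L.1 R.1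
  set N : BMat T d := R.1 * O with hN
  have hNL : N ∈ bL T d := mul_mem_bL R.2 hO.1
  have hdN : frob (N - L.1) = u * D := by
    rw [frob_sub_comm, hN, ← orbitDist_eq hO, ← dist_cls, hR, γ.dist_start]
  refine ⟨⟨(u : ℝ)⁻¹ • (N - L.1), smul_mem_bL _ (sub_mem_bL hNL L.2)⟩, ?_, fun v hv => ?_⟩
  · rw [frob_smul, hdN, abs_of_pos (inv_pos.2 hu'), inv_mul_cancel_left₀ hu'.ne']
  · have hv' : (u : ℝ) ≤ v := hv
    obtain ⟨S, hS⟩ := cls_surjective (γ.toFun v)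
    obtain ⟨Q, hQ⟩ := exists_mem_Ostar N S.1
    have h1 : frob (S.1 * Q - N) = (v - u) * D := by
      rw [frob_sub_comm, ← orbitDist_eq hQ, hN, orbitDist_mul_left _ _ hO.1, ← dist_cls, hR, hS,
        γ.const_speed, ← hD, abs_sub_comm, abs_of_nonneg (sub_nonneg.2 hv')]
    -- The optimal lifts L, N, SQ are joined by steps of length uD and (v - u)D, while the orbits of
    -- L and S are at distance vD. So the lifts are collinear, and the direction depends on N alone,
    -- not on v.
    have h2 : (u + (v - u)) * D ≤ frob ((N - L.1) + (S.1 * Q - N)) := by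
      have e : (u + (v - u)) * D = orbitDist L.1 (S.1 * Q) := by
        rw [orbitDist_mul_right _ _ hQ.1, ← dist_cls, hS, γ.dist_start, ← hD]
        ring
      rw [e]
      refine (orbitDist_le_frob _ _).trans (le_of_eq ?_)
      rw [frob_sub_comm]
      congr 1
      abel
    have h3 := smul_eq_smul_of_le_frob_add hu'.le (sub_nonneg.2 hv') hD0 hdN h1 h2
    rw [← hS]
    refine Quotient.sound ⟨Qᵀ, bO_transpose hQ.1, ?_⟩
    rw [show S.1 = S.1 * Q * Qᵀ from (mul_mul_transpose_bO S.1 hQ.1).symm]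
    congr 1
    change S.1 * Q = L.1 + (v : ℝ) • ((u : ℝ)⁻¹ • (N - L.1))
    have h4 : S.1 * Q - N = (u : ℝ)⁻¹ • ((v : ℝ) - u) • (N - L.1) := by
      rw [← h3, smul_smul, inv_mul_cancel₀ hu'.ne', one_smul]
    rw [sub_eq_iff_eq_add.1 h4, smul_comm (v : ℝ), sub_smul, smul_sub, smul_smul _ (u : ℝ),
      inv_mul_cancel₀ hu'.ne', one_smul]
    abel

/-- The hypothesis makes O = 1 a minimizer in 𝐎*(L, L + V). First-order optimality gives symmetric
diagonal blocks of (L + V)ᵀL, and those of LᵀL are symmetric anyway. -/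
lemma calV_of_optimal {L V : bL T d} (h : orbitDist L.1 (L.1 + V.1) = frob V.1) :
    V.1 ∈ calV L.1 := by
  refine ⟨V.2, fun t => ?_⟩
  have hopt : (1 : BMat T d) ∈ Ostar L.1 (L.1 + V.1) := by
    refine ⟨bO_one T d, fun O hO => ?_⟩
    rw [Matrix.mul_one, sub_add_cancel_left, frob_neg, ← h]
    exact orbitDist_le hO _ _
  have h1 := (isSymm_and_nonneg_of_mem_Ostar hopt t).1
  have h2 : (block ((L.1)ᵀ * L.1) t t).IsSymm := by
    rw [block_transpose_mul]
    rw [Matrix.IsSymm, Matrix.transpose_mul, Matrix.transpose_transpose]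
  have e : block ((V.1)ᵀ * L.1) t t =
      block (((L.1 + V.1) * 1)ᵀ * L.1) t t - block ((L.1)ᵀ * L.1) t t := by
    rw [Matrix.mul_one, Matrix.transpose_add, Matrix.add_mul]
    ext i j
    simp [block]
  rw [e]
  exact h1.sub h2

/-- Every non-constant constant speed geodesic from `[L]` is of the form `u ↦ [L + uV]` with
`V ∈ 𝓥(L)`. -/
lemma Geod.exists_ray {L : bL T d} (γ : Geod (cls L)) :
    ∃ V : bL T d, V.1 ∈ calV L.1 ∧ frob V.1 = dist (γ.toFun 0) (γ.toFun 1) ∧ 0 < frob V.1 ∧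
      ∀ u : unitInterval, γ.toFun u = cls (ray L V u) := by
  set D := dist (γ.toFun 0) (γ.toFun 1) with hD
  -- The ray lifted from time `s n` represents γ only past `s n`, and its direction may vary with n.
  -- All directions have norm D, so a subsequence converges; its limit serves all times.
  let s : ℕ → unitInterval := fun n => ⟨1 / ((n : ℝ) + 1), by positivity, by
    rw [div_le_one (by positivity)]
    linarith [n.cast_nonneg (α := ℝ)]⟩
  have hs : ∀ n, 0 < s n := fun n => by
    change (0 : ℝ) < 1 / ((n : ℝ) + 1)
    positivity
  choose W hW using fun n => γ.exists_ray_of_pos (hs n)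
  have : FirstCountableTopology (BMat T d) :=
    inferInstanceAs (FirstCountableTopology (Fin d × Fin T → Fin d × Fin T → ℝ))
  obtain ⟨V, ⟨hVL, hVD⟩, φ, hφ, hlim⟩ := (isCompact_frob_eq isClosed_bL D).tendsto_subseq
    (x := fun n => (W n).1) fun n => ⟨(W n).2, (hW n).1⟩
  have hray : ∀ u : unitInterval, γ.toFun u = cls (ray L ⟨V, hVL⟩ u) := by
    intro u
    rcases eq_or_lt_of_le (show 0 ≤ u from u.2.1) with rfl | hu
    · rw [γ.start, Set.Icc.coe_zero, ray_zero]
    have hev : ∀ᶠ n in atTop, γ.toFun u = cls (ray L (W (φ n)) u) := by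
      have h1 : Tendsto (fun n => 1 / ((φ n : ℝ) + 1)) atTop (𝓝 0) :=
        tendsto_one_div_add_atTop_nhds_zero_nat.comp hφ.tendsto_atTop
      filter_upwards [h1.eventually (gt_mem_nhds (show (0 : ℝ) < u from hu))] with n hn
      exact (hW (φ n)).2 u hn.le
    have h2 : Tendsto (fun n => frob ((u : ℝ) • (W (φ n)).1 - (u : ℝ) • V)) atTop (𝓝 0) := by
      have h3 : Continuous fun A : BMat T d => frob ((u : ℝ) • A - (u : ℝ) • V) :=
        continuous_frob.comp (by fun_prop)
      have h4 := (h3.tendsto V).comp hlim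
      simpa [frob_zero, Function.comp_def] using h4
    have h5 : dist (γ.toFun u) (cls (ray L ⟨V, hVL⟩ u)) ≤ 0 := by
      refine ge_of_tendsto h2 (hev.mono fun n hn => ?_)
      rw [hn, dist_cls, ← frob_ray_sub L (W (φ n)) ⟨V, hVL⟩ u u]
      exact orbitDist_le_frob _ _
    exact dist_le_zero.1 h5
  refine ⟨⟨V, hVL⟩, calV_of_optimal ?_, hVD, ?_, hray⟩
  · have h1 := hray 1
    rw [Set.Icc.coe_one] at h1
    have h2 : dist (cls L) (γ.toFun 1) = D := by rw [γ.dist_start, Set.Icc.coe_one, one_mul]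
    rw [h1, dist_cls] at h2
    simpa [ray, hVD] using h2
  · obtain ⟨u, hu⟩ := γ.nonconst
    change 0 < frob V
    refine (frob_nonneg V).lt_of_ne fun h0 => hu ?_
    rw [← dist_eq_zero, dist_comm, γ.dist_start, ← hD, ← hVD, ← h0, mul_zero]

/-- Directions in `𝓥(L)` realise the orbit distance for small times. -/
lemma exists_orbitDist_ray_eq {L V : bL T d} (hV : V.1 ∈ calV L.1) :
    ∃ ε : ℝ, 0 < ε ∧ ∀ a b : ℝ, 0 ≤ a → a ≤ b → b ≤ ε →
      orbitDist (ray L V a).1 (ray L V b).1 = (b - a) * frob V.1 := by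
  obtain ⟨C, hC0, hC⟩ := exists_abs_matInner_le_of_mem_calV hV
  -- It suffices that 2Cu ≤ 1 for u ≤ ε: then ‖L - LO‖² keeps a nonnegative coefficient 1 - 2Cu. The
  -- extra 1 covers C = 0.
  refine ⟨1 / (2 * C + 1), by positivity, ?_⟩
  have hstart : ∀ u : ℝ, 0 ≤ u → u ≤ 1 / (2 * C + 1) →
      u * frob V.1 ≤ orbitDist L.1 (ray L V u).1 := by
    intro u hu0 hu
    rw [orbitDist_comm]
    refine le_orbitDist fun O hO => ?_
    refine le_of_sq_le_sq ?_ (frob_nonneg _) 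
    have e : (ray L V u).1 - L.1 * O = (L.1 - L.1 * O) + u • V.1 := by
      simp only [ray]
      abel
    rw [e, frob_add_sq, matInner_smul_right, frob_smul, mul_pow, mul_pow, sq_abs]
    have h1 := (abs_le.1 (hC O hO)).1
    have h2 : u * (2 * C + 1) ≤ 1 := (le_div_iff₀ (by positivity)).1 hu
    have h3 := mul_le_mul_of_nonneg_left h1 hu0
    nlinarith [mul_nonneg (sq_nonneg (frob (L.1 - L.1 * O))) (show 0 ≤ 1 - 2 * C * u by linarith)]
  intro a b ha hab hb
  have hle : ∀ a b : ℝ, a ≤ b →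
      orbitDist (ray L V a).1 (ray L V b).1 ≤ (b - a) * frob V.1 := by
    intro a b hab
    refine (orbitDist_le_frob _ _).trans (le_of_eq ?_)
    rw [frob_ray_sub, ← sub_smul, frob_smul, abs_sub_comm, abs_of_nonneg (sub_nonneg.2 hab)]
  refine le_antisymm (hle a b hab) ?_
  -- Minimality from L up to time b is inherited by the segment from a to b.
  have h1 := orbitDist_triangle L.1 (ray L V a).1 (ray L V b).1
  have h2 := hle 0 a ha
  rw [ray_zero] at h2
  linarith [hstart b (ha.trans hab) hb]

/-- The geodesic in direction `V ∈ 𝓥(L)`. -/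
lemma exists_geod {L V : bL T d} (hV : V.1 ∈ calV L.1) (hV0 : 0 < frob V.1) :
    ∃ ε : ℝ, 0 < ε ∧ ∃ γ : Geod (cls L), ∀ u : unitInterval, γ.toFun u = cls (ray L V (u * ε)) := by
  obtain ⟨ε, hε, h⟩ := exists_orbitDist_ray_eq hV
  have hle : ∀ u v : unitInterval, u ≤ v →
      dist (cls (ray L V (u * ε))) (cls (ray L V (v * ε))) = (v - u) * (ε * frob V.1) := by
    intro u v huv
    have huv' : (u : ℝ) ≤ v := huv
    rw [dist_cls, h _ _ (mul_nonneg u.2.1 hε.le) (mul_le_mul_of_nonneg_right huv' hε.le)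
      (mul_le_of_le_one_left hε.le v.2.2)]
    ring
  have h01 : dist (cls (ray L V ((0 : unitInterval) * ε))) (cls (ray L V ((1 : unitInterval) * ε)))
      = ε * frob V.1 := by
    rw [hle 0 1 zero_le_one]
    simp
  refine ⟨ε, hε, ⟨fun u => cls (ray L V (u * ε)), by simp [ray_zero], fun u v => ?_, 1, ?_⟩,
    fun u => rfl⟩
  · rw [h01]
    rcases le_total u v with huv | huv
    · have huv' : (u : ℝ) ≤ v := huv
      rw [hle u v huv, abs_sub_comm, abs_of_nonneg (sub_nonneg.2 huv')]
    · have huv' : (v : ℝ) ≤ u := huv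
      rw [dist_comm, hle v u huv, abs_of_nonneg (sub_nonneg.2 huv')]
  · intro heq
    have : dist (cls (ray L V ((0 : unitInterval) * ε)))
        (cls (ray L V ((1 : unitInterval) * ε))) = 0 := by
      rw [show cls (ray L V ((1 : unitInterval) * ε)) = cls L from heq]
      simp [ray_zero]
    rw [h01] at this
    have := mul_pos hε hV0
    linarith

/-- The first order expansion of the orbit distance along rays in directions of `𝓥(L)`. -/
lemma tendsto_orbitDist_ray_div {L V W : bL T d} (hV : V.1 ∈ calV L.1) (hW : W.1 ∈ calV L.1) :
    Tendsto (fun u : ℝ => orbitDist (ray L V u).1 (ray L W u).1 / u) (𝓝[>] 0)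
      (𝓝 (distOstar L.1 V.1 W.1)) := by
  obtain ⟨C₁, hC₁0, hC₁⟩ := exists_abs_matInner_le_of_mem_calV hV
  obtain ⟨C₂, hC₂0, hC₂⟩ := exists_abs_matInner_le_of_mem_calV hW
  -- The cross term is 2u (⟨L - LO, V⟩ + ⟨L - LOᵀ, W⟩). Both products are of second order by
  -- normality, and both displacements have the same norm.
  have hexp : ∀ u : ℝ, 0 ≤ u → ∀ O ∈ bO T d,
      (1 - 2 * (C₁ + C₂) * u) * frob (L.1 - L.1 * O) ^ 2 + u ^ 2 * frob (V.1 - W.1 * O) ^ 2 ≤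
        frob ((ray L V u).1 - (ray L W u).1 * O) ^ 2 := by
    intro u hu O hO
    have e : (ray L V u).1 - (ray L W u).1 * O = (L.1 - L.1 * O) + u • (V.1 - W.1 * O) := by
      simp only [ray, Matrix.add_mul, Matrix.smul_mul, smul_sub]
      abel
    rw [e, frob_add_sq, matInner_smul_right, frob_smul, mul_pow, sq_abs, matInner_sub_right]
    have h1 := (abs_le.1 (hC₁ O hO)).1
    have h2 := (abs_le.1 (hC₂ _ (bO_transpose hO))).1
    have e2 : matInner (L.1 - L.1 * O) (W.1 * O) = - matInner (L.1 - L.1 * Oᵀ) W.1 := by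
      rw [matInner_mul_bO_right _ _ hO, Matrix.sub_mul, mul_mul_transpose_bO _ hO,
        matInner_sub_left, matInner_sub_left]
      ring
    have e3 : frob (L.1 - L.1 * Oᵀ) = frob (L.1 - L.1 * O) := by
      rw [frob_sub_mul_bO _ _ (bO_transpose hO), Matrix.transpose_transpose, frob_sub_comm]
    rw [e3] at h2
    rw [e2]
    have h3 := mul_le_mul_of_nonneg_left (add_le_add h1 h2) hu
    nlinarith
  rw [tendsto_order]
  refine ⟨fun δ hδ => ?_, fun δ hδ => ?_⟩
  · rcases lt_or_ge δ 0 with hδ0 | hδ0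
    · filter_upwards [self_mem_nhdsWithin] with u hu
      exact hδ0.trans_le (div_nonneg (orbitDist_nonneg _ _) (le_of_lt hu))
    obtain ⟨δ', hδδ', hδ'⟩ := exists_between hδ
    -- Rotations with ‖V - WO‖ ≤ δ' avoid the stabilizer, so by compactness they move L by at least
    -- η. For small u their squared cost, at least η²/2, exceeds u²δ'², which bounds the cost of all
    -- other rotations from below.
    obtain ⟨η, hη, hηK⟩ : ∃ η : ℝ, 0 < η ∧
        ∀ O ∈ bO T d, frob (V.1 - W.1 * O) ≤ δ' → η ≤ frob (L.1 - L.1 * O) := by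
      have hcont : ∀ A B : BMat T d, Continuous fun O : BMat T d => frob (A - B * O) :=
        fun A B => continuous_frob.comp (continuous_const.sub (continuous_const.mul continuous_id))
      have hK : IsCompact {O | O ∈ bO T d ∧ frob (V.1 - W.1 * O) ≤ δ'} :=
        isCompact_bO.inter_right (isClosed_le (hcont _ _) continuous_const)
      rcases Set.eq_empty_or_nonempty {O | O ∈ bO T d ∧ frob (V.1 - W.1 * O) ≤ δ'} with he | hne
      · refine ⟨1, one_pos, fun O hO h => ?_⟩
        have : O ∈ {O | O ∈ bO T d ∧ frob (V.1 - W.1 * O) ≤ δ'} := ⟨hO, h⟩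
        rw [he] at this
        exact this.elim
      · obtain ⟨O, ⟨hO, hO'⟩, hmin⟩ := hK.exists_isMinOn hne (hcont L.1 L.1).continuousOn
        refine ⟨frob (L.1 - L.1 * O), (frob_nonneg _).lt_of_ne fun h0 => ?_,
          fun Q hQ h => hmin ⟨hQ, h⟩⟩
        have hstar : O ∈ Ostar L.1 L.1 :=
          mem_Ostar_self.2 ⟨hO, (sub_eq_zero.1 (frob_eq_zero h0.symm)).symm⟩
        linarith [distOstar_le hstar V.1 W.1]
    have hev1 : ∀ᶠ u : ℝ in 𝓝[>] 0, 2 * (C₁ + C₂) * u < 1 / 2 := by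
      have : Tendsto (fun u : ℝ => 2 * (C₁ + C₂) * u) (𝓝[>] 0) (𝓝 (2 * (C₁ + C₂) * 0)) :=
        (Continuous.tendsto (by fun_prop) _).mono_left nhdsWithin_le_nhds
      exact this.eventually (gt_mem_nhds (by simp))
    have hev2 : ∀ᶠ u : ℝ in 𝓝[>] 0, u ^ 2 * δ' ^ 2 < 1 / 2 * η ^ 2 := by
      have : Tendsto (fun u : ℝ => u ^ 2 * δ' ^ 2) (𝓝[>] 0) (𝓝 (0 ^ 2 * δ' ^ 2)) :=
        (Continuous.tendsto (by fun_prop) _).mono_left nhdsWithin_le_nhds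
      exact this.eventually (gt_mem_nhds (by simp only [ne_eq, OfNat.ofNat_ne_zero,
        not_false_eq_true, zero_pow, zero_mul]; positivity))
    filter_upwards [hev1, hev2, self_mem_nhdsWithin] with u h1 h2 hu
    have hu0 : (0 : ℝ) < u := hu
    refine hδδ'.trans_le ((le_div_iff₀ hu0).2 (le_orbitDist fun O hO => ?_))
    refine le_of_sq_le_sq ((le_trans ?_ (hexp u hu0.le O hO))) (frob_nonneg _)
    have h3 : 1 / 2 * frob (L.1 - L.1 * O) ^ 2 ≤
        (1 - 2 * (C₁ + C₂) * u) * frob (L.1 - L.1 * O) ^ 2 :=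
      mul_le_mul_of_nonneg_right (by linarith) (sq_nonneg _)
    rcases le_total (frob (V.1 - W.1 * O)) δ' with hle | hle
    · have h4 := pow_le_pow_left₀ hη.le (hηK O hO hle) 2
      have h5 : 0 ≤ u ^ 2 * frob (V.1 - W.1 * O) ^ 2 := by positivity
      nlinarith
    · have h4 := mul_le_mul_of_nonneg_left
        (pow_le_pow_left₀ (hδ0.trans hδδ'.le) hle 2) (sq_nonneg u)
      nlinarith [sq_nonneg (frob (L.1 - L.1 * O))]
  -- For the upper bound only rotations fixing L compete, and for them the L terms cancel exactly.
  · filter_upwards [self_mem_nhdsWithin] with u hu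
    have hu0 : (0 : ℝ) < u := hu
    refine lt_of_le_of_lt ((div_le_iff₀ hu0).2 ?_) hδ
    rw [← div_le_iff₀ hu0]
    refine le_distOstar fun O hO => ?_
    obtain ⟨hO1, hO2⟩ := mem_Ostar_self.1 hO
    rw [div_le_iff₀ hu0]
    refine (orbitDist_le hO1 _ _).trans (le_of_eq ?_)
    have e : (ray L V u).1 - (ray L W u).1 * O = u • (V.1 - W.1 * O) := by
      simp only [ray, Matrix.add_mul, Matrix.smul_mul, smul_sub, hO2]
      abel
    rw [e, frob_smul, abs_of_pos hu0, mul_comm]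

end OrbitDistance

/-! ### Angles between directions -/

section Directions

variable {T d : ℕ}

lemma transpose_mem_Ostar {L O : BMat T d} (hO : O ∈ Ostar L L) : Oᵀ ∈ Ostar L L := by
  obtain ⟨hO1, hO2⟩ := mem_Ostar_self.1 hO
  refine mem_Ostar_self.2 ⟨bO_transpose hO1, ?_⟩
  nth_rewrite 1 [← hO2]
  exact mul_mul_transpose_bO L hO1

lemma mul_mem_Ostar {L O Q : BMat T d} (hO : O ∈ Ostar L L) (hQ : Q ∈ Ostar L L) :
    O * Q ∈ Ostar L L := by
  obtain ⟨hO1, hO2⟩ := mem_Ostar_self.1 hO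
  obtain ⟨hQ1, hQ2⟩ := mem_Ostar_self.1 hQ
  exact mem_Ostar_self.2 ⟨bO_mul hO1 hQ1, by rw [← Matrix.mul_assoc, hO2, hQ2]⟩

lemma exists_distOstar_eq (L V W : BMat T d) :
    ∃ O ∈ Ostar L L, distOstar L V W = frob (V - W * O) := by
  have hcompact : IsCompact (Ostar L L) := by
    have : Ostar L L = bO T d ∩ {O | L * O = L} := by
      ext O
      exact mem_Ostar_self
    rw [this]
    exact isCompact_bO.inter_right
      (isClosed_eq (continuous_const.mul continuous_id) continuous_const)
  obtain ⟨O, hO, hmin⟩ := hcompact.exists_isMinOn ⟨1, one_mem_Ostar L⟩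
    (f := fun O => frob (V - W * O))
    (continuous_frob.comp (continuous_const.sub (continuous_const.mul continuous_id))).continuousOn
  exact ⟨O, hO, le_antisymm (distOstar_le hO V W) (le_distOstar fun Q hQ => hmin hQ)⟩

lemma distOstar_nonneg (L V W : BMat T d) : 0 ≤ distOstar L V W :=
  le_distOstar fun _ _ => frob_nonneg _

/-- The inner product of `V` and `W` after optimal alignment under the stabilizer of `L`. -/
def starInner (L V W : BMat T d) : ℝ := (frob V ^ 2 + frob W ^ 2 - distOstar L V W ^ 2) / 2

lemma distOstar_sq (L V W : BMat T d) :
    distOstar L V W ^ 2 = frob V ^ 2 + frob W ^ 2 - 2 * starInner L V W := by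
  rw [starInner]
  ring

/-- All WO have the norm of W, so `starInner` is the maximum of ⟨V, WO⟩ over the stabilizer; the
next lemma says that it is attained. -/
lemma matInner_le_starInner {L O : BMat T d} (hO : O ∈ Ostar L L) (V W : BMat T d) :
    matInner V (W * O) ≤ starInner L V W := by
  have h := pow_le_pow_left₀ (distOstar_nonneg L V W) (distOstar_le hO V W) 2
  rw [frob_sub_sq, frob_mul W hO.1, distOstar_sq] at h
  linarith

lemma exists_starInner_eq (L V W : BMat T d) :
    ∃ O ∈ Ostar L L, starInner L V W = matInner V (W * O) := by
  obtain ⟨O, hO, h⟩ := exists_distOstar_eq L V W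
  refine ⟨O, hO, ?_⟩
  have h2 := distOstar_sq L V W
  rw [h, frob_sub_sq, frob_mul W hO.1] at h2
  linarith

lemma starInner_comm (L V W : BMat T d) : starInner L V W = starInner L W V := by
  have key : ∀ V W : BMat T d, starInner L V W ≤ starInner L W V := by
    intro V W
    obtain ⟨O, hO, h⟩ := exists_starInner_eq L V W
    rw [h, matInner_mul_bO_right _ _ hO.1, matInner_comm]
    exact matInner_le_starInner (transpose_mem_Ostar hO) W V
  exact le_antisymm (key V W) (key W V)

lemma starInner_smul {a b : ℝ} (ha : 0 ≤ a) (hb : 0 ≤ b) (L V W : BMat T d) :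
    starInner L (a • V) (b • W) = a * b * starInner L V W := by
  refine le_antisymm ?_ ?_
  · obtain ⟨O, hO, h⟩ := exists_starInner_eq L (a • V) (b • W)
    rw [h, Matrix.smul_mul, matInner_smul_left, matInner_smul_right, ← mul_assoc]
    exact mul_le_mul_of_nonneg_left (matInner_le_starInner hO V W) (mul_nonneg ha hb)
  · obtain ⟨O, hO, h⟩ := exists_starInner_eq L V W
    rw [h, mul_assoc, ← matInner_smul_right, ← matInner_smul_left, ← Matrix.smul_mul]
    exact matInner_le_starInner hO _ _

/-- The angle between the classes of `V` and `W` modulo the stabilizer of `L`. -/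
def dirAngle (L V W : BMat T d) : ℝ := Real.arccos (starInner L V W / (frob V * frob W))

lemma angle_matVec (V W : BMat T d) :
    InnerProductGeometry.angle (matVec V) (matVec W) =
      Real.arccos (matInner V W / (frob V * frob W)) := by
  rw [InnerProductGeometry.angle, inner_matVec, norm_matVec_eq_frob, norm_matVec_eq_frob]

lemma dirAngle_le {L O : BMat T d} (hO : O ∈ Ostar L L) (V W : BMat T d) :
    dirAngle L V W ≤ InnerProductGeometry.angle (matVec V) (matVec (W * O)) := by
  rw [angle_matVec, frob_mul W hO.1]
  exact Real.antitone_arccos (div_le_div_of_nonneg_right (matInner_le_starInner hO V W)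
    (mul_nonneg (frob_nonneg _) (frob_nonneg _)))

lemma exists_dirAngle_eq (L V W : BMat T d) : ∃ O ∈ Ostar L L,
    dirAngle L V W = InnerProductGeometry.angle (matVec V) (matVec (W * O)) := by
  obtain ⟨O, hO, h⟩ := exists_starInner_eq L V W
  exact ⟨O, hO, by rw [angle_matVec, frob_mul W hO.1, dirAngle, h]⟩

/-- `starInner` is a genuine inner product at an optimal O, so Cauchy–Schwarz keeps the argument of
arccos in [-1, 1]. -/
lemma cos_dirAngle (L V W : BMat T d) :
    Real.cos (dirAngle L V W) = starInner L V W / (frob V * frob W) := by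
  obtain ⟨O, hO, h⟩ := exists_starInner_eq L V W
  rw [dirAngle, h, ← frob_mul W hO.1, ← angle_matVec, InnerProductGeometry.cos_angle,
    inner_matVec, norm_matVec_eq_frob, norm_matVec_eq_frob]

lemma dirAngle_nonneg (L V W : BMat T d) : 0 ≤ dirAngle L V W := Real.arccos_nonneg _

lemma dirAngle_le_pi (L V W : BMat T d) : dirAngle L V W ≤ Real.pi := Real.arccos_le_pi _

lemma dirAngle_comm (L V W : BMat T d) : dirAngle L V W = dirAngle L W V := by
  rw [dirAngle, dirAngle, starInner_comm, mul_comm (frob V)]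

/-- Align V with U and then W with V. A common rotation preserves angles, so the triangle inequality
for angles of vectors applies. -/
lemma dirAngle_triangle (L U V W : BMat T d) :
    dirAngle L U W ≤ dirAngle L U V + dirAngle L V W := by
  obtain ⟨O, hO, h⟩ := exists_dirAngle_eq L U V
  obtain ⟨Q, hQ, h'⟩ := exists_dirAngle_eq L V W
  have e : InnerProductGeometry.angle (matVec V) (matVec (W * Q)) =
      InnerProductGeometry.angle (matVec (V * O)) (matVec (W * (Q * O))) := by
    rw [angle_matVec, angle_matVec, ← Matrix.mul_assoc, matInner_mul_bO _ _ hO.1,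
      frob_mul _ hO.1, frob_mul _ hO.1]
  rw [h, h', e]
  exact (dirAngle_le (mul_mem_Ostar hQ hO) U W).trans
    (InnerProductGeometry.angle_le_angle_add_angle _ _ _)

/-- Proportional directions, up to the stabilizer of `L`, have angle zero. -/
lemma dirAngle_eq_zero {L V O : BMat T d} (hO : O ∈ Ostar L L) (hV : 0 < frob V) {c : ℝ}
    (hc : 0 < c) : dirAngle L V ((c • V) * O) = 0 := by
  refine le_antisymm ((dirAngle_le (transpose_mem_Ostar hO) _ _).trans (le_of_eq ?_))
    (dirAngle_nonneg _ _ _)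
  rw [mul_mul_transpose_bO _ hO.1, angle_matVec, matInner_smul_right, frob_smul, abs_of_pos hc,
    ← frob_sq, Real.arccos_eq_zero]
  apply le_of_eq
  field_simp

lemma smul_mem_calV {L V : BMat T d} (c : ℝ) (hV : V ∈ calV L) : c • V ∈ calV L := by
  refine ⟨smul_mem_bL c hV.1, fun t => ?_⟩
  have e : block ((c • V)ᵀ * L) t t = c • block (Vᵀ * L) t t := by
    rw [Matrix.transpose_smul, Matrix.smul_mul]
    rfl
  rw [e]
  exact (hV.2 t).smul c

lemma self_mem_calV {L : BMat T d} (hL : L ∈ bL T d) : L ∈ calV L := by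
  refine ⟨hL, fun t => ?_⟩
  rw [block_transpose_mul, Matrix.IsSymm, Matrix.transpose_mul, Matrix.transpose_transpose]

lemma isClosed_calV (L : BMat T d) : IsClosed (calV L) := by
  have : calV L = bL T d ∩ ⋂ t, {V | (block (Vᵀ * L) t t)ᵀ = block (Vᵀ * L) t t} := by
    ext V
    simp [calV, Matrix.IsSymm]
  rw [this]
  refine isClosed_bL.inter (isClosed_iInter fun t => ?_)
  have hc : Continuous fun V : BMat T d => block (Vᵀ * L) t t :=
    Continuous.matrix_submatrix (by fun_prop) _ _
  exact isClosed_eq hc.matrix_transpose hc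

/-- L is normal to its own orbit. If L = 0, every element of 𝐋 is normal, and the identity is
nonzero because T and d are positive. -/
lemma exists_calV_pos (hT : 0 < T) (hd : 0 < d) (L : bL T d) :
    ∃ V : bL T d, V.1 ∈ calV L.1 ∧ 0 < frob V.1 := by
  by_cases hL : L.1 = 0
  · have h1 : (1 : BMat T d) ∈ bL T d := by
      intro t s hts
      ext i j
      simp [block, hts.ne]
    refine ⟨⟨1, h1⟩, ⟨h1, fun t => ?_⟩, (frob_nonneg _).lt_of_ne fun h => ?_⟩
    · rw [hL, Matrix.mul_zero]
      exact Matrix.isSymm_zero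
    · have h2 := congrFun (congrFun (frob_eq_zero h.symm) (⟨0, hd⟩, ⟨0, hT⟩)) (⟨0, hd⟩, ⟨0, hT⟩)
      simp at h2
  · exact ⟨L, self_mem_calV L.2, (frob_nonneg _).lt_of_ne fun h => hL (frob_eq_zero h.symm)⟩

end Directions

/-! ### The angle metric on geodesics -/

section AngleMetric

variable {T d : ℕ}

attribute [local instance] orbitMetricSpace

/-- The initial direction of a geodesic from `[L]`. -/
def Geod.dir {L : bL T d} (γ : Geod (cls L)) : bL T d := γ.exists_ray.choose

lemma Geod.dir_mem {L : bL T d} (γ : Geod (cls L)) : γ.dir.1 ∈ calV L.1 :=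
  γ.exists_ray.choose_spec.1

lemma Geod.frob_dir {L : bL T d} (γ : Geod (cls L)) :
    frob γ.dir.1 = dist (γ.toFun 0) (γ.toFun 1) := γ.exists_ray.choose_spec.2.1

lemma Geod.frob_dir_pos {L : bL T d} (γ : Geod (cls L)) : 0 < frob γ.dir.1 :=
  γ.exists_ray.choose_spec.2.2.1

lemma Geod.eq_ray {L : bL T d} (γ : Geod (cls L)) (u : unitInterval) :
    γ.toFun u = cls (ray L γ.dir u) := γ.exists_ray.choose_spec.2.2.2 u

lemma dirAngle_self {L V : BMat T d} (hV : 0 < frob V) : dirAngle L V V = 0 := by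
  simpa using dirAngle_eq_zero (one_mem_Ostar L) hV one_pos

/-- The angle, as a pseudo-metric on the geodesics from `[L]`. -/
@[reducible]
def angleMetric (L : bL T d) : PseudoMetricSpace (Geod (cls L)) where
  dist γ η := dirAngle L.1 γ.dir.1 η.dir.1
  dist_self γ := dirAngle_self γ.frob_dir_pos
  dist_comm _ _ := dirAngle_comm _ _ _
  dist_triangle _ _ _ := dirAngle_triangle _ _ _ _

attribute [local instance] angleMetric

lemma dist_geod {L : bL T d} (γ η : Geod (cls L)) :
    dist γ η = dirAngle L.1 γ.dir.1 η.dir.1 := rfl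

lemma tendsto_coe_unitInterval :
    Tendsto ((↑) : unitInterval → ℝ) (𝓝[>] 0) (𝓝[>] 0) := by
  refine tendsto_nhdsWithin_iff.2 ⟨?_, ?_⟩
  · exact (continuous_subtype_val.tendsto (0 : unitInterval)).mono_left nhdsWithin_le_nhds
  · filter_upwards [self_mem_nhdsWithin] with u hu
    exact hu

lemma isAngleMetric_angleMetric (L : bL T d) : IsAngleMetric (cls L) (angleMetric L) := by
  intro γ η
  refine ⟨dirAngle_le_pi _ _ _, ?_⟩
  change Tendsto _ _ (𝓝 (Real.cos (dirAngle L.1 γ.dir.1 η.dir.1)))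
  have h1 := (tendsto_orbitDist_ray_div γ.dir_mem η.dir_mem).comp tendsto_coe_unitInterval
  have h2 : Tendsto (fun u : unitInterval => (frob γ.dir.1 ^ 2 + frob η.dir.1 ^ 2 -
      (orbitDist (ray L γ.dir u).1 (ray L η.dir u).1 / u) ^ 2) /
        (2 * frob γ.dir.1 * frob η.dir.1)) (𝓝[>] 0)
      (𝓝 ((frob γ.dir.1 ^ 2 + frob η.dir.1 ^ 2 - distOstar L.1 γ.dir.1 η.dir.1 ^ 2) /
        (2 * frob γ.dir.1 * frob η.dir.1))) :=
    (tendsto_const_nhds.sub (h1.pow 2)).div_const _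
  have e : Real.cos (dirAngle L.1 γ.dir.1 η.dir.1) =
      (frob γ.dir.1 ^ 2 + frob η.dir.1 ^ 2 - distOstar L.1 γ.dir.1 η.dir.1 ^ 2) /
        (2 * frob γ.dir.1 * frob η.dir.1) := by
    rw [cos_dirAngle, starInner, div_div, mul_assoc]
  rw [e]
  refine h2.congr' ?_
  filter_upwards [self_mem_nhdsWithin] with u hu
  have hu0 : (0 : ℝ) < u := hu
  have hγ := γ.frob_dir_pos
  have hη := η.frob_dir_pos
  -- Distances from [L] are exactly u times the norm of the direction, so u cancels from the
  -- comparison cosine.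
  rw [compCos, γ.dist_start, η.dist_start, ← γ.frob_dir, ← η.frob_dir, γ.eq_ray, η.eq_ray, dist_cls]
  field_simp

/-- Two rays in directions of `𝓥(L)` inducing the same curve agree up to the stabilizer of `L`. -/
lemma exists_dir_eq_mul {L V : bL T d} (hV : V.1 ∈ calV L.1) {ε : ℝ} (γ : Geod (cls L))
    (h : ∀ u : unitInterval, γ.toFun u = cls (ray L V (u * ε))) :
    ∃ O ∈ Ostar L.1 L.1, γ.dir.1 = (ε • V.1) * O := by
  set W : bL T d := ⟨ε • V.1, smul_mem_bL ε V.2⟩ with hW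
  have hray : ∀ u : ℝ, ray L V (u * ε) = ray L W u := by
    intro u
    simp [ray, hW, smul_smul]
  have h1 := (tendsto_orbitDist_ray_div γ.dir_mem (W := W)
    (smul_mem_calV ε hV)).comp tendsto_coe_unitInterval
  have h2 : (fun u : ℝ => orbitDist (ray L γ.dir u).1 (ray L W u).1 / u) ∘
      ((↑) : unitInterval → ℝ) = fun _ => 0 := by
    funext u
    have h3 : dist (γ.toFun u) (γ.toFun u) = 0 := dist_self _
    nth_rewrite 1 [γ.eq_ray] at h3
    rw [h, hray, dist_cls] at h3
    simp only [Function.comp_apply]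
    rw [h3, zero_div]
  rw [h2] at h1
  have hne : (𝓝[>] (0 : unitInterval)).NeBot :=
    nhdsGT_neBot_of_exists_gt ⟨1, zero_lt_one⟩
  have h4 := tendsto_nhds_unique h1 tendsto_const_nhds
  obtain ⟨O, hO, h5⟩ := exists_distOstar_eq L.1 γ.dir.1 W.1
  rw [h4] at h5
  exact ⟨O, hO, sub_eq_zero.1 (frob_eq_zero h5.symm)⟩

lemma exists_geod_dirAngle_eq_zero {L V : bL T d} (hV : V.1 ∈ calV L.1) (hV0 : 0 < frob V.1) :
    ∃ γ : Geod (cls L), dirAngle L.1 V.1 γ.dir.1 = 0 := by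
  obtain ⟨ε, hε, γ, hγ⟩ := exists_geod hV hV0
  obtain ⟨O, hO, h⟩ := exists_dir_eq_mul hV γ hγ
  exact ⟨γ, by rw [h]; exact dirAngle_eq_zero hO hV0 hε⟩

lemma continuous_matVec : Continuous (matVec : BMat T d → _) :=
  (PiLp.continuous_toLp 2 _).comp (by fun_prop)

/-- The space of directions at `[L]` is compact. -/
lemma compactSpace_directions (L : bL T d) : CompactSpace (SeparationQuotient (Geod (cls L))) := by
  -- The unit sphere of 𝓥(L) maps onto the directions without increasing angles, so a compact set
  -- has the space of directions as its continuous image.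
  let S : Set (BMat T d) := {V | V ∈ calV L.1 ∧ frob V = 1}
  have hS : CompactSpace S := isCompact_iff_compactSpace.1 (isCompact_frob_eq (isClosed_calV L.1) 1)
  have hpos : ∀ V : S, 0 < frob V.1 := fun V => by
    rw [V.2.2]
    exact one_pos
  choose g hg' using fun V : S =>
    exists_geod_dirAngle_eq_zero (L := L) (V := ⟨V.1, V.2.1.1⟩) V.2.1 (hpos V)
  have hg : ∀ V : S, dirAngle L.1 V.1 (g V).dir.1 = 0 := hg'
  let f : S → SeparationQuotient (Geod (cls L)) := fun V => SeparationQuotient.mk (g V)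
  have hdist : ∀ V W : S, dist (f V) (f W) ≤
      InnerProductGeometry.angle (matVec V.1) (matVec W.1) := by
    intro V W
    rw [SeparationQuotient.dist_mk, dist_geod]
    have h1 := dirAngle_triangle L.1 (g V).dir.1 V.1 (g W).dir.1
    have h2 := dirAngle_triangle L.1 V.1 W.1 (g W).dir.1
    have h3 := dirAngle_le (one_mem_Ostar L.1) V.1 W.1
    rw [Matrix.mul_one] at h3
    rw [dirAngle_comm L.1 _ V.1, hg V] at h1
    linarith [hg W]
  have hf : Continuous f := by
    rw [continuous_iff_continuousAt]
    intro W
    rw [ContinuousAt, tendsto_iff_dist_tendsto_zero]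
    have hne : matVec W.1 ≠ 0 := by
      rw [← norm_ne_zero_iff, norm_matVec_eq_frob]
      exact (hpos W).ne'
    have h1 : Tendsto (fun V : S => InnerProductGeometry.angle (matVec V.1) (matVec W.1)) (𝓝 W)
        (𝓝 (InnerProductGeometry.angle (matVec W.1) (matVec W.1))) := by
      have h2 := InnerProductGeometry.continuousAt_angle (x := (matVec W.1, matVec W.1)) hne hne
      have h3 : ContinuousAt (fun V : S => (matVec V.1, matVec W.1)) W :=
        ((continuous_matVec.comp continuous_subtype_val).prodMk continuous_const).continuousAt
      exact ContinuousAt.comp (f := fun V : S => (matVec V.1, matVec W.1)) h2 h3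
    rw [InnerProductGeometry.angle_self hne] at h1
    exact squeeze_zero (fun _ => dist_nonneg) (fun V => hdist V W) h1
  have hsurj : Function.Surjective f := by
    intro x
    obtain ⟨γ, rfl⟩ := SeparationQuotient.surjective_mk x
    have hγ := γ.frob_dir_pos
    refine ⟨⟨(frob γ.dir.1)⁻¹ • γ.dir.1, smul_mem_calV _ γ.dir_mem, ?_⟩, ?_⟩
    · rw [frob_smul, abs_of_pos (inv_pos.2 hγ), inv_mul_cancel₀ hγ.ne']
    · rw [← dist_eq_zero]
      refine le_antisymm ?_ dist_nonneg
      rw [SeparationQuotient.dist_mk, dist_geod]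
      refine (dirAngle_triangle _ _ ((frob γ.dir.1)⁻¹ • γ.dir.1) _).trans (le_of_eq ?_)
      rw [dirAngle_comm L.1 (g _).dir.1, hg ⟨_, _⟩, dirAngle_comm, zero_add]
      simpa using dirAngle_eq_zero (one_mem_Ostar L.1) hγ (inv_pos.2 hγ)
  rw [← isCompact_univ_iff, ← hsurj.range_eq]
  exact isCompact_range hf

/-- The compact space of directions is both closed and dense in its completion. -/
lemma exists_geod_eq {L : bL T d}
    (p : UniformSpace.Completion (SeparationQuotient (Geod (cls L)))) :
    ∃ γ : Geod (cls L), p = ((SeparationQuotient.mk γ : SeparationQuotient (Geod (cls L))) :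
      UniformSpace.Completion (SeparationQuotient (Geod (cls L)))) := by
  have := compactSpace_directions L
  have hr : Set.range ((↑) : SeparationQuotient (Geod (cls L)) →
      UniformSpace.Completion (SeparationQuotient (Geod (cls L)))) = Set.univ := by
    rw [← (isCompact_range (UniformSpace.Completion.continuous_coe _)).isClosed.closure_eq]
    exact UniformSpace.Completion.denseRange_coe.closure_range
  obtain ⟨x, rfl⟩ : p ∈ Set.range _ := hr ▸ Set.mem_univ p
  obtain ⟨γ, rfl⟩ := SeparationQuotient.surjective_mk x
  exact ⟨γ, rfl⟩

/-! ### The isometry from the tangent cone -/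

/-- A geodesic representing a point of the completed space of directions. -/
def repGeod {L : bL T d} (p : UniformSpace.Completion (SeparationQuotient (Geod (cls L)))) :
    Geod (cls L) := (exists_geod_eq p).choose

lemma dist_eq_dirAngle {L : bL T d}
    (p q : UniformSpace.Completion (SeparationQuotient (Geod (cls L)))) :
    dist p q = dirAngle L.1 (repGeod p).dir.1 (repGeod q).dir.1 := by
  conv_lhs => rw [(exists_geod_eq p).choose_spec, (exists_geod_eq q).choose_spec]
  rw [UniformSpace.Completion.dist_eq, SeparationQuotient.dist_mk]
  rfl

/-- The vector of length `r` in the direction `p`. -/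
def scaledDir {L : bL T d} (p : UniformSpace.Completion (SeparationQuotient (Geod (cls L))))
    (r : ℝ) : VSpace L.1 :=
  ⟨(r / frob (repGeod p).dir.1) • (repGeod p).dir.1, smul_mem_calV _ (repGeod p).dir_mem⟩

lemma frob_scaledDir {L : bL T d}
    (p : UniformSpace.Completion (SeparationQuotient (Geod (cls L)))) {r : ℝ} (hr : 0 ≤ r) :
    frob (scaledDir p r).1 = r := by
  have h := (repGeod p).frob_dir_pos
  rw [scaledDir, frob_smul, abs_of_nonneg (by positivity), div_mul_cancel₀ _ h.ne']

lemma dist_scaledDir {L : bL T d}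
    (p q : UniformSpace.Completion (SeparationQuotient (Geod (cls L)))) {r s : ℝ} (hr : 0 ≤ r)
    (hs : 0 ≤ s) :
    dist (scaledDir p r) (scaledDir q s) =
      √(r ^ 2 + s ^ 2 - 2 * r * s * Real.cos (dist p q)) := by
  have h := (repGeod p).frob_dir_pos
  have h' := (repGeod q).frob_dir_pos
  have e : dist (scaledDir p r) (scaledDir q s) ^ 2 =
      r ^ 2 + s ^ 2 - 2 * r * s * Real.cos (dist p q) := by
    change distOstar L.1 _ _ ^ 2 = _
    rw [distOstar_sq, frob_scaledDir p hr, frob_scaledDir q hs, scaledDir, scaledDir,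
      starInner_smul (by positivity) (by positivity), dist_eq_dirAngle, cos_dirAngle]
    field_simp
  rw [← e, Real.sqrt_sq dist_nonneg]

/-- The isometry from the tangent cone at `[L]` to `𝓥(L)` modulo the stabilizer of `L`. -/
def coneIso (L : bL T d) : TangentCone (cls L) → VQuot L.1 :=
  Quotient.lift (fun p => SeparationQuotient.mk (scaledDir p.1 p.2)) (by
    rintro p q (rfl | ⟨h, h'⟩)
    · rfl
    · simp [scaledDir, h, h'])

lemma dist_coneIso (L : bL T d) (p q : TangentCone (cls L)) :
    dist (coneIso L p) (coneIso L q) = coneDist p q := by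
  obtain ⟨⟨p, r⟩, rfl⟩ := Quotient.exists_rep p
  obtain ⟨⟨q, s⟩, rfl⟩ := Quotient.exists_rep q
  exact (SeparationQuotient.dist_mk _ _).trans (dist_scaledDir p q r.2 s.2)

/-- The squared cone distance is (r - s)² + 2rs (1 - cos). Away from the tip its vanishing forces
cos = 1, hence angle 0 because angles do not exceed π. -/
lemma eq_of_coneDist_eq_zero {L : bL T d} {p q : TangentCone (cls L)} (h : coneDist p q = 0) :
    p = q := by
  obtain ⟨⟨p, r⟩, rfl⟩ := Quotient.exists_rep p
  obtain ⟨⟨q, s⟩, rfl⟩ := Quotient.exists_rep q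
  refine Quotient.sound ?_
  have hr : (0 : ℝ) ≤ r := r.2
  have hs : (0 : ℝ) ≤ s := s.2
  have hc := Real.cos_le_one (dist p q)
  have h1 : √((r : ℝ) ^ 2 + (s : ℝ) ^ 2 - 2 * r * s * Real.cos (dist p q)) = 0 := h
  rw [Real.sqrt_eq_zero'] at h1
  have h2 : 0 ≤ (r : ℝ) * s * (1 - Real.cos (dist p q)) :=
    mul_nonneg (mul_nonneg hr hs) (by linarith)
  have h3 : ((r : ℝ) - s) ^ 2 = 0 := le_antisymm (by nlinarith) (sq_nonneg _)
  have hrs : (r : ℝ) = s := sub_eq_zero.1 (pow_eq_zero_iff two_ne_zero |>.1 h3)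
  obtain rfl : r = s := NNReal.coe_injective hrs
  by_cases hr0 : r = 0
  · exact Or.inr ⟨hr0, hr0⟩
  · left
    have hr1 : (0 : ℝ) < (r : ℝ) * r := by
      have : (0 : ℝ) < r := lt_of_le_of_ne hr fun h0 => hr0 (NNReal.coe_injective h0.symm)
      positivity
    have h4 : Real.cos (dist p q) = 1 := by nlinarith
    have h5 : dist p q = 0 := by
      refine Real.injOn_cos ⟨dist_nonneg, ?_⟩ ⟨le_rfl, Real.pi_pos.le⟩ (by rw [h4, Real.cos_zero])
      rw [dist_eq_dirAngle]
      exact dirAngle_le_pi _ _ _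
    rw [dist_eq_zero.1 h5]

lemma coneIso_surjective (hT : 0 < T) (hd : 0 < d) (L : bL T d) :
    Function.Surjective (coneIso L) := by
  have key : ∀ V : VSpace L.1, 0 < frob V.1 → ∃ x, coneIso L x = SeparationQuotient.mk V := by
    intro V hV
    obtain ⟨γ, hγ⟩ := exists_geod_dirAngle_eq_zero (L := L) (V := ⟨V.1, V.2.1⟩) V.2 hV
    let p : UniformSpace.Completion (SeparationQuotient (Geod (cls L))) :=
      ((SeparationQuotient.mk γ : SeparationQuotient (Geod (cls L))) :
        UniformSpace.Completion (SeparationQuotient (Geod (cls L))))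
    have hp : dirAngle L.1 γ.dir.1 (repGeod p).dir.1 = 0 := by
      have h1 := (exists_geod_eq p).choose_spec
      have h2 : dist p p = 0 := dist_self p
      nth_rewrite 2 [h1] at h2
      rwa [UniformSpace.Completion.dist_eq, SeparationQuotient.dist_mk] at h2
    have hVp : dirAngle L.1 V.1 (repGeod p).dir.1 = 0 := by
      refine le_antisymm ((dirAngle_triangle _ _ γ.dir.1 _).trans ?_) (dirAngle_nonneg _ _ _)
      rw [hp, add_zero]
      exact hγ.le
    refine ⟨Quotient.mk _ (p, ⟨frob V.1, hV.le⟩), ?_⟩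
    change SeparationQuotient.mk (scaledDir p (frob V.1)) = SeparationQuotient.mk V
    rw [← dist_eq_zero, SeparationQuotient.dist_mk, dist_comm]
    have hpos := (repGeod p).frob_dir_pos
    have hs := starInner_smul (zero_le_one) (show 0 ≤ frob V.1 / frob (repGeod p).dir.1 by positivity)
      L.1 V.1 (repGeod p).dir.1
    have hc := cos_dirAngle L.1 V.1 (repGeod p).dir.1
    rw [hVp, Real.cos_zero, eq_div_iff (by positivity)] at hc
    have h1 : dist V (scaledDir p (frob V.1)) ^ 2 = 0 := by
      change distOstar L.1 _ _ ^ 2 = _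
      rw [one_smul] at hs
      rw [distOstar_sq, frob_scaledDir p hV.le, scaledDir, hs, ← hc]
      field_simp
      ring
    exact pow_eq_zero_iff two_ne_zero |>.1 h1
  intro y
  obtain ⟨V, rfl⟩ := SeparationQuotient.surjective_mk y
  rcases (frob_nonneg V.1).lt_or_eq with hV | hV
  · exact key V hV
  -- The zero vector comes from the tip, but a representative of the tip still needs some direction
  -- p.
  · obtain ⟨W, hW, hW0⟩ := exists_calV_pos hT hd L
    obtain ⟨x, -⟩ := key ⟨W.1, hW⟩ hW0
    obtain ⟨⟨p, r⟩, rfl⟩ := Quotient.exists_rep x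
    refine ⟨Quotient.mk _ (p, 0), ?_⟩
    change SeparationQuotient.mk (scaledDir p 0) = SeparationQuotient.mk V
    congr 1
    refine Subtype.ext ?_
    rw [scaledDir, frob_eq_zero hV.symm]
    simp

lemma coneIso_bijective (hT : 0 < T) (hd : 0 < d) (L : bL T d) :
    Function.Bijective (coneIso L) := by
  refine ⟨fun p q h => eq_of_coneDist_eq_zero ?_, coneIso_surjective hT hd L⟩
  rw [← dist_coneIso, h, dist_self]

end AngleMetric

/-! ### Invariance of nested conditional laws under a change of basis -/

section NestedLaw

variable {Ω : Type*} {m : MeasurableSpace Ω} [mΩ : MeasurableSpace Ω]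

/-- The exceptional null set depends on s; comparing the joint measures on a standard Borel target
yields one null set for all s. -/
lemma kernel_ae_eq_of_forall_apply {β : Type*} [MeasurableSpace β] [StandardBorelSpace β]
    {P : Measure Ω} [IsFiniteMeasure P] {κ η : Kernel Ω β} [IsFiniteKernel κ] [IsFiniteKernel η]
    (h : ∀ s, MeasurableSet s → (fun ω => κ ω s) =ᵐ[P] fun ω => η ω s) : κ =ᵐ[P] η := by
  refine Kernel.ae_eq_of_compProd_eq (Measure.ext_prod fun {s t} hs ht => ?_)
  rw [Measure.compProd_apply_prod hs ht, Measure.compProd_apply_prod hs ht]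
  exact setLIntegral_congr_fun_ae hs ((h t ht).mono fun ω hω _ => hω)

variable [StandardBorelSpace Ω] {P : Measure Ω} [IsProbabilityMeasure P]

/-- Averaging the conditional measures gives back P, so a P-null set is null for almost all of them.
-/
lemma ae_ae_condExpKernel (hm : m ≤ mΩ) {p : Ω → Prop}
    (h : ∀ᵐ ω ∂P, p ω) : ∀ᵐ ω ∂P, ∀ᵐ x ∂(condExpKernel P m ω), p x := by
  rw [← condExpKernel_comp_trim (μ := P) hm] at h
  exact ae_of_ae_trim hm (Measure.ae_ae_of_ae_comp h)

/-- The conditional law of `X` given the `σ`-algebra of `H` is the conditional distribution of `X`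
given `H`. -/
lemma condLaw_comap_ae_eq {β γ : Type*} [MeasurableSpace β] [StandardBorelSpace β] [Nonempty β]
    [mγ : MeasurableSpace γ] {X : Ω → β} {H : Ω → γ} (hX : Measurable X) (hH : Measurable H) :
    condLaw (mγ.comap H) P X =ᵐ[P] fun ω => condDistrib X H P (H ω) := by
  let κ : Kernel Ω β := ((condExpKernel P (mγ.comap H)).map X).comap id
    (measurable_id'' hH.comap_le)
  let η : Kernel Ω β := (condDistrib X H P).comap H hH
  have : IsMarkovKernel ((condExpKernel P (mγ.comap H)).map X) := Kernel.IsMarkovKernel.map _ hX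
  have h : κ =ᵐ[P] η := by
    refine kernel_ae_eq_of_forall_apply fun s hs => ?_
    exact (condDistrib_apply_ae_eq_condExpKernel_map hX hH hs).symm
  filter_upwards [h] with ω hω
  have h1 : κ ω = condLaw (mγ.comap H) P X ω := Kernel.map_apply _ hX _
  rw [← h1, hω]
  rfl

lemma condLaw_congr (hm : m ≤ mΩ) {α : Type*} [MeasurableSpace α]
    {X Y : Ω → α} (h : X =ᵐ[P] Y) : condLaw m P X =ᵐ[P] condLaw m P Y := by
  filter_upwards [ae_ae_condExpKernel hm h] with ω hω
  exact Measure.map_congr hω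

variable {T d : ℕ}

/-- The restriction of a path to its first `n` coordinates. -/
def restrictPath (T d n : ℕ) (g : Fin T → EuclideanSpace ℝ (Fin d)) :
    {s : Fin T // (s : ℕ) < n} → EuclideanSpace ℝ (Fin d) := fun s => g s

lemma measurable_restrictPath (T d n : ℕ) : Measurable (restrictPath T d n) := by
  unfold restrictPath
  fun_prop

omit [StandardBorelSpace Ω] mΩ in
lemma pastSigma_eq_comap (G : Fin T → Ω → EuclideanSpace ℝ (Fin d)) (n : ℕ) :
    pastSigma G n = MeasurableSpace.comap (fun ω => restrictPath T d n fun t => G t ω)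
      inferInstance := by
  simp only [pastSigma, MeasurableSpace.pi, MeasurableSpace.comap_iSup, MeasurableSpace.comap_comp]
  rfl

omit [StandardBorelSpace Ω] in
lemma pastSigma_le {G : Fin T → Ω → EuclideanSpace ℝ (Fin d)} (hG : ∀ t, Measurable (G t))
    (n : ℕ) : pastSigma G n ≤ mΩ :=
  iSup_le fun s => (hG s).comap_le

/-- Nested conditional laws of a functional only depend on the law of the underlying path. -/
lemma sameNestedLaw_of_map_eq {G G' : Fin T → Ω → EuclideanSpace ℝ (Fin d)}
    (hG : ∀ t, Measurable (G t)) (hG' : ∀ t, Measurable (G' t))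
    (hlaw : P.map (fun ω t => G t ω) = P.map (fun ω t => G' t ω))
    (hσ : ∀ n, pastSigma G' n = pastSigma G n) (n : ℕ) :
    ∀ {α : Type} [MeasurableSpace α] (Φ : (Fin T → EuclideanSpace ℝ (Fin d)) → α),
      Measurable Φ → ∀ X Y : Ω → α, (X =ᵐ[P] fun ω => Φ fun t => G t ω) →
      (Y =ᵐ[P] fun ω => Φ fun t => G' t ω) → SameNestedLaw P (pastSigma G) n X Y := by
  have hGm : Measurable fun ω t => G t ω := measurable_pi_iff.2 hG
  have hGm' : Measurable fun ω t => G' t ω := measurable_pi_iff.2 hG'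
  induction n with
  | zero =>
    intro α _ Φ hΦ X Y hX hY
    change P.map X = P.map Y
    rw [Measure.map_congr hX, Measure.map_congr hY]
    change P.map (Φ ∘ fun ω t => G t ω) = P.map (Φ ∘ fun ω t => G' t ω)
    rw [← Measure.map_map hΦ hGm, ← Measure.map_map hΦ hGm', hlaw]
  | succ n ih =>
    intro α _ Φ hΦ X Y hX hY
    let h := restrictPath T d (n + 1)
    have hh : Measurable h := measurable_restrictPath T d (n + 1)
    let ν := P.map fun ω t => G t ω
    let κ := condDistrib id h ν
    -- For both bases the conditional law is obtained from the past by the same kernel κ, which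
    -- depends on the law of the path only. It is therefore again one measurable functional, now
    -- measure-valued, of either path, and the induction continues.
    have key : ∀ H : Fin T → Ω → EuclideanSpace ℝ (Fin d), (∀ t, Measurable (H t)) →
        P.map (fun ω t => H t ω) = ν → pastSigma H (n + 1) = pastSigma G (n + 1) →
        ∀ Z : Ω → α, (Z =ᵐ[P] fun ω => Φ fun t => H t ω) →
        condLaw (pastSigma G (n + 1)) P Z =ᵐ[P]
          fun ω => (κ (h fun t => H t ω)).map Φ := by
      intro H hH hHν hHσ Z hZ
      have hHm : Measurable fun ω t => H t ω := measurable_pi_iff.2 hH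
      refine (condLaw_congr (pastSigma_le hG _) hZ).trans ?_
      have h1 := condLaw_comap_ae_eq (P := P) hHm (hh.comp hHm)
      have h2 := condDistrib_map (ν := P) (f := fun ω t => H t ω) (X := h) (Y := id)
        hh.aemeasurable measurable_id.aemeasurable hHm.aemeasurable
      simp only [hHν] at h2
      have h3 := ae_of_ae_map (hh.comp hHm).aemeasurable h2
      rw [← hHσ, pastSigma_eq_comap]
      filter_upwards [h1, h3] with ω h4 h5
      have h6 : condLaw (MeasurableSpace.comap (fun ω => h fun t => H t ω) inferInstance) P
          (fun ω => Φ fun t => H t ω) ω =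
          (condLaw (MeasurableSpace.comap (fun ω => h fun t => H t ω) inferInstance) P
            (fun ω t => H t ω) ω).map Φ := (Measure.map_map hΦ hHm).symm
      refine h6.trans ?_
      congr 1
      exact h4.trans h5.symm
    exact ih (fun g => (κ (h g)).map Φ)
      ((Measure.measurable_map Φ hΦ).comp (κ.measurable.comp hh)) _ _
      (key G hG rfl rfl X hX) (key G' hG' hlaw.symm (hσ _) Y hY)

/-! ### Rotations of the noise -/

/-- The process obtained by rotating the noise. -/
def rotate (U : Fin T → Matrix (Fin d) (Fin d) ℝ) (G : Fin T → Ω → EuclideanSpace ℝ (Fin d)) :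
    Fin T → Ω → EuclideanSpace ℝ (Fin d) :=
  fun t ω => WithLp.toLp 2 (U t *ᵥ (G t ω).ofLp)

omit [StandardBorelSpace Ω] mΩ in
lemma linProcess_mul_blockDiagonal (G : Fin T → Ω → EuclideanSpace ℝ (Fin d)) (M : BMat T d)
    (U : Fin T → Matrix (Fin d) (Fin d) ℝ) :
    linProcess G (M * Matrix.blockDiagonal U) = linProcess (rotate U G) M := by
  have hb : ∀ t s, block (M * Matrix.blockDiagonal U) t s = block M t s * U s := by
    intro t s
    ext i j
    exact congrFun (congrFun (colBlock_mul_blockDiagonal M U s) (i, t)) j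
  funext t ω
  simp [linProcess, rotate, hb, Matrix.mulVec_mulVec]

lemma measurable_toLp_mulVec (A : Matrix (Fin d) (Fin d) ℝ) :
    Measurable fun x : EuclideanSpace ℝ (Fin d) =>
      (WithLp.toLp 2 (A *ᵥ x.ofLp) : EuclideanSpace ℝ (Fin d)) :=
  (Matrix.toEuclideanCLM (n := Fin d) (𝕜 := ℝ) A).continuous.measurable

lemma map_rotation_stdGaussian {U : Matrix (Fin d) (Fin d) ℝ}
    (hU : U ∈ Matrix.orthogonalGroup (Fin d) ℝ) :
    (stdGaussian (EuclideanSpace ℝ (Fin d))).map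
      (fun x => (WithLp.toLp 2 (U *ᵥ x.ofLp) : EuclideanSpace ℝ (Fin d))) =
      stdGaussian (EuclideanSpace ℝ (Fin d)) := by
  have hmem : Matrix.toEuclideanCLM (n := Fin d) (𝕜 := ℝ) U ∈
      unitary (EuclideanSpace ℝ (Fin d) →L[ℝ] EuclideanSpace ℝ (Fin d)) :=
    Unitary.map_mem (Matrix.toEuclideanCLM (n := Fin d) (𝕜 := ℝ)) hU
  exact stdGaussian_map (Unitary.linearIsometryEquiv ⟨_, hmem⟩)

omit [StandardBorelSpace Ω] [IsProbabilityMeasure P] in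
lemma isGaussianBasis_rotate {G : Fin T → Ω → EuclideanSpace ℝ (Fin d)}
    (hG : IsGaussianBasis P G) {U : Fin T → Matrix (Fin d) (Fin d) ℝ}
    (hU : ∀ t, U t ∈ Matrix.orthogonalGroup (Fin d) ℝ) : IsGaussianBasis P (rotate U G) where
  measurable t := (measurable_toLp_mulVec (U t)).comp (hG.measurable t)
  indep := hG.indep.comp _ fun t => measurable_toLp_mulVec (U t)
  law t := by
    rw [← map_rotation_stdGaussian (hU t), ← hG.law t,
      Measure.map_map (measurable_toLp_mulVec (U t)) (hG.measurable t)]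
    rfl

omit [StandardBorelSpace Ω] [IsProbabilityMeasure P] in
lemma map_eq_of_isGaussianBasis {G G' : Fin T → Ω → EuclideanSpace ℝ (Fin d)}
    (hG : IsGaussianBasis P G) (hG' : IsGaussianBasis P G') :
    P.map (fun ω t => G t ω) = P.map (fun ω t => G' t ω) := by
  rw [hG.indep.map_fun_eq_pi_map fun t => (hG.measurable t).aemeasurable,
    hG'.indep.map_fun_eq_pi_map fun t => (hG'.measurable t).aemeasurable]
  congr 1
  funext t
  rw [hG.law t, hG'.law t]

omit [StandardBorelSpace Ω] mΩ in
lemma pastSigma_rotate (G : Fin T → Ω → EuclideanSpace ℝ (Fin d))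
    {U : Fin T → Matrix (Fin d) (Fin d) ℝ} (hU : ∀ t, U t ∈ Matrix.orthogonalGroup (Fin d) ℝ)
    (n : ℕ) : pastSigma (rotate U G) n = pastSigma G n := by
  have key : ∀ (V : Fin T → Matrix (Fin d) (Fin d) ℝ) (H : Fin T → Ω → EuclideanSpace ℝ (Fin d)),
      pastSigma (rotate V H) n ≤ pastSigma H n := by
    intro V H
    refine iSup_mono fun s => ?_
    have : rotate V H s = (fun x : EuclideanSpace ℝ (Fin d) =>
        (WithLp.toLp 2 (V s *ᵥ x.ofLp) : EuclideanSpace ℝ (Fin d))) ∘ H s := rfl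
    rw [this, ← MeasurableSpace.comap_comp]
    exact MeasurableSpace.comap_mono (measurable_toLp_mulVec (V s)).comap_le
  refine le_antisymm (key U G) ?_
  have h := key (fun t => (U t)ᵀ) (rotate U G)
  have e : rotate (fun t => (U t)ᵀ) (rotate U G) = G := by
    funext t ω
    have h1 : (U t)ᵀ * U t = 1 := by
      simpa [Matrix.star_eq_conjTranspose] using
        (Matrix.mem_orthogonalGroup_iff' (Fin d) ℝ).1 (hU t)
    simp [rotate, Matrix.mulVec_mulVec, h1]
  rwa [e] at h

omit [StandardBorelSpace Ω] mΩ in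
lemma measurable_linProcess_pi (M : BMat T d) :
    Measurable fun (g : Fin T → EuclideanSpace ℝ (Fin d)) (t : Fin T) =>
      (∑ s, WithLp.toLp 2 (block M t s *ᵥ (g s).ofLp) : EuclideanSpace ℝ (Fin d)) :=
  measurable_pi_iff.2 fun t => Finset.measurable_fun_sum _ fun s _ =>
    (measurable_toLp_mulVec (block M t s)).comp (measurable_pi_apply s)

/-- Multiplication by an element of `𝐎` does not change the adapted law of `MG`. -/
lemma sameAdaptedLaw_linProcess_mul {G : Fin T → Ω → EuclideanSpace ℝ (Fin d)}
    (hG : IsGaussianBasis P G) (M : BMat T d) {O : BMat T d} (hO : O ∈ bO T d) :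
    SameAdaptedLaw P G (linProcess G (M * O)) (linProcess G M) := by
  obtain ⟨U, hU, rfl⟩ := hO
  rw [linProcess_mul_blockDiagonal]
  have hG' := isGaussianBasis_rotate hG hU
  have h := sameNestedLaw_of_map_eq (P := P) hG'.measurable hG.measurable
    (map_eq_of_isGaussianBasis hG' hG) (fun n => (pastSigma_rotate G hU n).symm) (T - 1) _
    (measurable_linProcess_pi M) (fun ω t => linProcess (rotate U G) M t ω)
    (fun ω t => linProcess G M t ω) (EventuallyEq.refl _ _) (EventuallyEq.refl _ _)
  have e : pastSigma (rotate U G) = pastSigma G := funext fun n => pastSigma_rotate G hU n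
  rwa [e] at h

end NestedLaw

/-! ### Conditional expectations are determined by nested conditional laws -/

section NestedMoments

/-- The integral of `f`, as a measurable function of the measure. -/
def mean {α : Type*} [MeasurableSpace α] (f : α → ℝ) (μ : Measure α) : ℝ :=
  (∫⁻ x, ENNReal.ofReal (f x) ∂μ).toReal - (∫⁻ x, ENNReal.ofReal (-f x) ∂μ).toReal

/-- Splitting into two lower integrals gives measurability in the measure without any integrability,
so `mean f` can itself serve as a functional one level deeper in the nested law. -/
lemma measurable_mean {α : Type*} [MeasurableSpace α] {f : α → ℝ} (hf : Measurable f) :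
    Measurable (mean f) :=
  (Measure.measurable_lintegral hf.ennreal_ofReal).ennreal_toReal.sub
    (Measure.measurable_lintegral hf.neg.ennreal_ofReal).ennreal_toReal

lemma mean_eq_integral {α : Type*} [MeasurableSpace α] {f : α → ℝ} {μ : Measure α}
    (hf : Integrable f μ) : mean f μ = ∫ x, f x ∂μ :=
  (integral_eq_lintegral_pos_part_sub_lintegral_neg_part hf).symm

variable {Ω : Type*} {m : MeasurableSpace Ω} [mΩ : MeasurableSpace Ω] [StandardBorelSpace Ω]
  {P : Measure Ω} [IsProbabilityMeasure P] {α : Type*} [MeasurableSpace α]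

lemma measurable_condLaw (hm : m ≤ mΩ) {X : Ω → α} (hX : Measurable X) :
    Measurable (condLaw m P X) :=
  (Measure.measurable_map X hX).comp ((condExpKernel P m).measurable.mono hm le_rfl)

lemma mean_condLaw_ae_eq (hm : m ≤ mΩ) {X : Ω → α} (hX : Measurable X) {f : α → ℝ}
    (hf : Measurable f) (hfX : Integrable (fun ω => f (X ω)) P) :
    (fun ω => mean f (condLaw m P X ω)) =ᵐ[P] P[fun ω => f (X ω) | m] := by
  filter_upwards [hfX.condExpKernel_ae (m := m), condExp_ae_eq_integral_condExpKernel hm hfX]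
    with ω h1 h2
  have h3 : Integrable f (condLaw m P X ω) :=
    (integrable_map_measure hf.aestronglyMeasurable hX.aemeasurable).2 h1
  rw [h2, mean_eq_integral h3]
  exact integral_map hX.aemeasurable hf.aestronglyMeasurable

/-- Averaging conditional laws forgets the conditioning; this strips one layer off a nested law. -/
lemma join_map_condLaw (hm : m ≤ mΩ) {X : Ω → α} (hX : Measurable X) :
    (P.map (condLaw m P X)).join = P.map X := by
  ext s hs
  rw [Measure.join_apply hs, lintegral_map (Measure.measurable_coe hs) (measurable_condLaw hm hX),
    Measure.map_apply hX hs]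
  have h1 : ∀ ω, condLaw m P X ω s = condExpKernel P m ω (X ⁻¹' s) := fun ω =>
    Measure.map_apply hX hs
  simp only [h1]
  rw [← lintegral_trim hm (measurable_condExpKernel (hX hs)),
    ← Measure.bind_apply (hX hs) (condExpKernel P m).measurable.aemeasurable,
    condExpKernel_comp_trim hm]

lemma SameNestedLaw.map_eq {𝓕 : ℕ → MeasurableSpace Ω} (h𝓕 : ∀ n, 𝓕 n ≤ mΩ) (n : ℕ) :
    ∀ {α : Type} [MeasurableSpace α] {X Y : Ω → α}, Measurable X → Measurable Y →
      SameNestedLaw P 𝓕 n X Y → P.map X = P.map Y := by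
  induction n with
  | zero => exact fun _ _ h => h
  | succ n ih =>
    intro α _ X Y hX hY h
    have h1 := ih (measurable_condLaw (h𝓕 (n + 1)) hX) (measurable_condLaw (h𝓕 (n + 1)) hY) h
    rw [← join_map_condLaw (h𝓕 (n + 1)) hX, h1, join_map_condLaw (h𝓕 (n + 1)) hY]

/-- The joint law of the conditional expectations of integrable functionals at a time `k ≤ n` is
determined by the nested conditional law. -/
lemma SameNestedLaw.map_condExp_eq {𝓕 : ℕ → MeasurableSpace Ω} (h𝓕 : ∀ n, 𝓕 n ≤ mΩ)
    (hmono : Monotone 𝓕) {ι : Type*} [Countable ι] (n : ℕ) :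
    ∀ {α : Type} [MeasurableSpace α] {X Y : Ω → α}, Measurable X → Measurable Y →
      SameNestedLaw P 𝓕 n X Y → ∀ f : ι → α → ℝ, (∀ i, Measurable (f i)) →
      (∀ i, Integrable (fun ω => f i (X ω)) P) → (∀ i, Integrable (fun ω => f i (Y ω)) P) →
      ∀ k, 1 ≤ k → k ≤ n → P.map (fun ω i => (P[fun ω => f i (X ω) | 𝓕 k]) ω) =
        P.map (fun ω i => (P[fun ω => f i (Y ω) | 𝓕 k]) ω) := by
  induction n with
  | zero => intro α _ X Y _ _ _ f _ _ _ k h1 h2; omega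
  | succ n ih =>
    intro α _ X Y hX hY h f hf hfX hfY k hk1 hkn
    have hXm := measurable_condLaw (P := P) (h𝓕 (n + 1)) hX
    have hYm := measurable_condLaw (P := P) (h𝓕 (n + 1)) hY
    have eX := fun i => mean_condLaw_ae_eq (h𝓕 (n + 1)) hX (hf i) (hfX i)
    have eY := fun i => mean_condLaw_ae_eq (h𝓕 (n + 1)) hY (hf i) (hfY i)
    rcases Nat.lt_or_ge n k with hlt | hle
    -- At time n + 1 the conditional expectations are means of the conditional law, whose
    -- distribution is known.
    · obtain rfl : k = n + 1 := by omega
      have hmeas : Measurable fun (μ : Measure α) i => mean (f i) μ :=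
        measurable_pi_iff.2 fun i => measurable_mean (hf i)
      have key : ∀ {Z : Ω → α}, Measurable Z →
          (∀ i, (fun ω => mean (f i) (condLaw (𝓕 (n + 1)) P Z ω)) =ᵐ[P]
            P[fun ω => f i (Z ω) | 𝓕 (n + 1)]) →
          P.map (fun ω i => (P[fun ω => f i (Z ω) | 𝓕 (n + 1)]) ω) =
            (P.map (condLaw (𝓕 (n + 1)) P Z)).map fun μ i => mean (f i) μ := by
        intro Z hZ eZ
        rw [Measure.map_map hmeas (measurable_condLaw (h𝓕 (n + 1)) hZ)]
        refine Measure.map_congr ?_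
        filter_upwards [ae_all_iff.2 eZ] with ω hω
        funext i
        exact (hω i).symm
      rw [key hX eX, key hY eY, SameNestedLaw.map_eq h𝓕 n hXm hYm h]
    -- At earlier times the tower property replaces f by `mean f` of the conditional law, which has
    -- one layer less.
    · have h1 := ih hXm hYm h (fun i => mean (f i)) (fun i => measurable_mean (hf i))
        (fun i => integrable_condExp.congr (eX i).symm)
        (fun i => integrable_condExp.congr (eY i).symm) k hk1 hle
      have key : ∀ {Z : Ω → α},
          (∀ i, (fun ω => mean (f i) (condLaw (𝓕 (n + 1)) P Z ω)) =ᵐ[P]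
            P[fun ω => f i (Z ω) | 𝓕 (n + 1)]) →
          P.map (fun ω i => (P[fun ω => f i (Z ω) | 𝓕 k]) ω) =
            P.map (fun ω i => (P[fun ω => mean (f i) (condLaw (𝓕 (n + 1)) P Z ω) | 𝓕 k]) ω) := by
        intro Z eZ
        refine Measure.map_congr ?_
        have h2 : ∀ i, P[fun ω => mean (f i) (condLaw (𝓕 (n + 1)) P Z ω) | 𝓕 k] =ᵐ[P]
            P[fun ω => f i (Z ω) | 𝓕 k] := fun i =>
          (condExp_congr_ae (eZ i)).trans
            (condExp_condExp_of_le (hmono (by omega)) (h𝓕 (n + 1)))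
        filter_upwards [ae_all_iff.2 h2] with ω hω
        funext i
        exact (hω i).symm
      rw [key eX, key eY, h1]

end NestedMoments

/-! ### A trace bound for families with prescribed Gram matrices -/

section Gram

variable {m n k : Type*} [Fintype m] [Fintype n] [Fintype k]
  {H : Type*} [NormedAddCommGroup H] [InnerProductSpace ℝ H]

omit [Fintype k] in
lemma inner_sum_smul_sum_smul (R : Matrix k m ℝ) (S : Matrix k n ℝ) (x : m → H) (y : n → H)
    (p q : k) :
    inner ℝ (∑ i, R p i • x i) (∑ j, S q j • y j) = ∑ i, ∑ j, R p i * S q j * inner ℝ (x i) (y j) := by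
  rw [sum_inner]
  refine Finset.sum_congr rfl fun i _ => ?_
  rw [inner_sum]
  refine Finset.sum_congr rfl fun j _ => ?_
  rw [real_inner_smul_left, real_inner_smul_right]
  ring

omit [Fintype k] in
lemma inner_sum_smul_of_gram {x : m → H} {S : Matrix m m ℝ} (hx : ∀ p q, inner ℝ (x p) (x q) = S p q)
    (R : Matrix k m ℝ) (p q : k) :
    inner ℝ (∑ i, R p i • x i) (∑ j, R q j • x j) = (R * S * Rᵀ) p q := by
  rw [inner_sum_smul_sum_smul, Matrix.mul_apply, Finset.sum_comm]
  refine Finset.sum_congr rfl fun j _ => ?_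
  rw [Matrix.mul_apply, Finset.sum_mul, Matrix.transpose_apply]
  refine Finset.sum_congr rfl fun i _ => ?_
  rw [hx]
  ring

/-- A family with Gram matrix `A Aᵀ` is of the form `A ξ`. -/
lemma exists_eq_sum_smul_of_gram [DecidableEq m] [DecidableEq n] {x : m → H} {A : Matrix m n ℝ}
    (hx : ∀ p q, inner ℝ (x p) (x q) = (A * Aᵀ) p q) :
    ∃ (ξ : n → H) (Q : Matrix n n ℝ), A * Q = A ∧ (∀ i j, inner ℝ (ξ i) (ξ j) = Q i j) ∧
      ∀ p, x p = ∑ i, A p i • ξ i := by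
  obtain ⟨g, hg, hsymm⟩ := exists_generalized_inverse A
  -- The Gram matrix of ξ = g x is the projection g A, not the identity, when A has a kernel. Only A
  -- Q = A is needed later, so H need not contain an orthonormal family.
  refine ⟨fun i => ∑ p, g i p • x p, g * A, by rw [← Matrix.mul_assoc, hg], fun i j => ?_,
    fun p => ?_⟩
  · rw [inner_sum_smul_of_gram hx]
    have e : g * (A * Aᵀ) * gᵀ = g * A := by
      calc g * (A * Aᵀ) * gᵀ = (g * A) * (g * A)ᵀ := by
            rw [Matrix.transpose_mul]
            simp only [Matrix.mul_assoc]
        _ = g * (A * g * A) := by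
            rw [hsymm]
            simp only [Matrix.mul_assoc]
        _ = g * A := by rw [hg]
    rw [e]
  · have hR : (1 - A * g) * A = 0 := by
      rw [Matrix.sub_mul, Matrix.one_mul, hg, sub_self]
    have h0 : ∑ q, (1 - A * g : Matrix m m ℝ) p q • x q = 0 := by
      rw [← inner_self_eq_zero (𝕜 := ℝ), inner_sum_smul_of_gram hx, ← Matrix.mul_assoc, hR]
      simp
    have h1 : ∑ q, (1 - A * g : Matrix m m ℝ) p q • x q = x p - ∑ q, (A * g) p q • x q := by
      simp [sub_smul, Finset.sum_sub_distrib, Matrix.one_apply]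
    rw [h1, sub_eq_zero] at h0
    rw [h0]
    simp only [Matrix.mul_apply, Finset.sum_smul, Finset.smul_sum, smul_smul]
    exact Finset.sum_comm

/-- N is a sum of matrices v vᵀ, each of which contributes a squared norm. -/
lemma sum_mul_inner_nonneg {N : Matrix n n ℝ} (hN : N.PosSemidef) (w : n → H) :
    0 ≤ ∑ i, ∑ j, N i j * inner ℝ (w i) (w j) := by
  obtain ⟨r, v, rfl⟩ := Matrix.posSemidef_iff_eq_sum_vecMulVec.1 hN
  have h : ∑ i, ∑ j, (∑ l, Matrix.vecMulVec (v l) (star (v l))) i j * inner ℝ (w i) (w j) =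
      ∑ l, inner ℝ (∑ i, v l i • w i) (∑ i, v l i • w i) := by
    have h1 : ∀ l, inner ℝ (∑ i, v l i • w i) (∑ i, v l i • w i) =
        ∑ i, ∑ j, v l i * v l j * inner ℝ (w i) (w j) := fun l =>
      inner_sum_smul_sum_smul (Matrix.of v) (Matrix.of v) w w l l
    simp only [h1, Matrix.sum_apply, Matrix.vecMulVec_apply, Finset.sum_mul, star_trivial]
    rw [Finset.sum_comm]
    conv_rhs => rw [Finset.sum_comm]
    rw [Finset.sum_comm]
    refine Finset.sum_congr rfl fun i _ => Finset.sum_comm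
  rw [h]
  exact Finset.sum_nonneg fun l _ => real_inner_self_nonneg

/-- The Gelbrich bound: if `Bᵀ A` is positive semidefinite then it bounds the correlation of two
families with Gram matrices `A Aᵀ` and `B Bᵀ`. -/
lemma sum_inner_le_trace [DecidableEq m] [DecidableEq n] {x y : m → H} {A B : Matrix m n ℝ}
    (hx : ∀ p q, inner ℝ (x p) (x q) = (A * Aᵀ) p q)
    (hy : ∀ p q, inner ℝ (y p) (y q) = (B * Bᵀ) p q) (hN : (Bᵀ * A).PosSemidef) :
    ∑ p, inner ℝ (x p) (y p) ≤ (Bᵀ * A).trace := by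
  obtain ⟨ξ, Q, hQ, hξ, hxξ⟩ := exists_eq_sum_smul_of_gram hx
  obtain ⟨ζ, R, hR, hζ, hyζ⟩ := exists_eq_sum_smul_of_gram hy
  have hsymm : ∀ i j, (Bᵀ * A) i j = (Bᵀ * A) j i := fun i j => by
    simpa using (congrFun (congrFun hN.1 i) j).symm
  have h1 : ∑ p, inner ℝ (x p) (y p) = ∑ i, ∑ j, (Bᵀ * A) i j * inner ℝ (ξ i) (ζ j) := by
    calc ∑ p, inner ℝ (x p) (y p) = ∑ p, ∑ i, ∑ j, A p i * B p j * inner ℝ (ξ i) (ζ j) := by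
          refine Finset.sum_congr rfl fun p _ => ?_
          rw [hxξ, hyζ, inner_sum_smul_sum_smul]
      _ = _ := by
          rw [Finset.sum_comm]
          refine Finset.sum_congr rfl fun i _ => ?_
          rw [Finset.sum_comm]
          refine Finset.sum_congr rfl fun j _ => ?_
          rw [hsymm, Matrix.mul_apply, Finset.sum_mul]
          refine Finset.sum_congr rfl fun p _ => ?_
          rw [Matrix.transpose_apply]
          ring
  have h2 : ∑ i, ∑ j, (Bᵀ * A) i j * inner ℝ (ξ i) (ξ j) = (Bᵀ * A).trace := by
    have : (Bᵀ * A * Q).trace = (Bᵀ * A).trace := by rw [Matrix.mul_assoc, hQ]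
    rw [← this]
    simp only [Matrix.trace, Matrix.diag, Matrix.mul_apply (M := Bᵀ * A), hξ]
    refine Finset.sum_congr rfl fun i _ => Finset.sum_congr rfl fun j _ => ?_
    rw [← hξ, real_inner_comm, hξ]
  have h3 : ∑ i, ∑ j, (Bᵀ * A) i j * inner ℝ (ζ i) (ζ j) = (Bᵀ * A).trace := by
    have e : Bᵀ * A = Aᵀ * B := by
      ext i j
      rw [hsymm, ← Matrix.transpose_apply (Bᵀ * A), Matrix.transpose_mul,
        Matrix.transpose_transpose]
    have : (Bᵀ * A * R).trace = (Bᵀ * A).trace := by rw [e, Matrix.mul_assoc, hR]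
    rw [← this]
    simp only [Matrix.trace, Matrix.diag, Matrix.mul_apply (M := Bᵀ * A), hζ]
    refine Finset.sum_congr rfl fun i _ => Finset.sum_congr rfl fun j _ => ?_
    rw [← hζ, real_inner_comm, hζ]
  have h4 : ∑ i, ∑ j, (Bᵀ * A) i j * inner ℝ (ζ i) (ξ j) =
      ∑ i, ∑ j, (Bᵀ * A) i j * inner ℝ (ξ i) (ζ j) := by
    rw [Finset.sum_comm]
    refine Finset.sum_congr rfl fun i _ => Finset.sum_congr rfl fun j _ => ?_
    rw [hsymm, real_inner_comm]
  -- In the expansion the two pure terms equal the trace, and the two mixed ones equal the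
  -- correlation.
  have h5 := sum_mul_inner_nonneg hN (fun i => ξ i - ζ i)
  simp only [inner_sub_left, inner_sub_right, mul_sub, Finset.sum_sub_distrib] at h5
  rw [h2, h3, h4, ← h1] at h5
  linarith

end Gram

/-! ### Second moments of conditional expectations -/

section Moments

variable {Ω : Type*} {m m' : MeasurableSpace Ω} [mΩ : MeasurableSpace Ω]
  {P : Measure Ω} [IsProbabilityMeasure P]

/-- The first factor is m-measurable, so conditioning on m projects the other one. This is what
makes martingale increments orthogonal. -/
lemma integral_condExp_mul_condExp_of_le (hm : m ≤ m') (hm' : m' ≤ mΩ) {f g : Ω → ℝ}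
    (hf : MemLp f 2 P) (hg : MemLp g 2 P) :
    ∫ ω, (P[f | m]) ω * (P[g | m']) ω ∂P = ∫ ω, (P[f | m]) ω * (P[g | m]) ω ∂P := by
  have hf' : MemLp (P[f | m]) 2 P := hf.condExp one_le_two
  have hg' : MemLp (P[g | m']) 2 P := hg.condExp one_le_two
  have h1 := integral_condExp (μ := P) (hm.trans hm') (f := P[f | m] * P[g | m'])
  have h2 := condExp_mul_of_stronglyMeasurable_left (μ := P)
    (stronglyMeasurable_condExp (m := m) (f := f)) (hf'.integrable_mul hg')
    (hg'.integrable one_le_two)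
  have h3 := condExp_condExp_of_le (μ := P) (f := g) hm hm'
  refine (show _ = _ from h1).symm.trans (integral_congr_ae ?_)
  filter_upwards [h2, h3] with ω h4 h5
  rw [h4, Pi.mul_apply, h5]

/-- The conditional expectation of `f` as an element of `L²`. -/
def condL2 (P : Measure Ω) [IsProbabilityMeasure P] (m : MeasurableSpace Ω) {f : Ω → ℝ}
    (hf : MemLp f 2 P) : Lp ℝ 2 P := (hf.condExp (m := m) one_le_two).toLp _

lemma inner_condL2 {f g : Ω → ℝ} (hf : MemLp f 2 P) (hg : MemLp g 2 P) :
    inner ℝ (condL2 P m hf) (condL2 P m' hg) = ∫ ω, (P[f | m]) ω * (P[g | m']) ω ∂P := by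
  rw [L2.inner_def]
  refine integral_congr_ae ?_
  filter_upwards [(hf.condExp (m := m) one_le_two).coeFn_toLp,
    (hg.condExp (m := m') one_le_two).coeFn_toLp] with ω h1 h2
  rw [condL2, condL2, h1, h2]
  simp [mul_comm]

variable {T d : ℕ}

/-- The scalar components of a process. -/
def coord (X : Fin T → Ω → EuclideanSpace ℝ (Fin d)) (p : Fin d × Fin T) (ω : Ω) : ℝ :=
  (X p.2 ω).ofLp p.1

/-- The components of the process at time `k`, projected to the past, have second moments
`condGram`. -/
def condGram (P : Measure Ω) (G X : Fin T → Ω → EuclideanSpace ℝ (Fin d)) (k : ℕ) : BMat T d :=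
  Matrix.of fun p q =>
    ∫ ω, (P[coord X p | pastSigma G k]) ω * (P[coord X q | pastSigma G k]) ω ∂P

omit mΩ in
lemma pastSigma_mono (G : Fin T → Ω → EuclideanSpace ℝ (Fin d)) : Monotone (pastSigma G) := by
  intro k l hkl
  exact iSup_le fun s => le_iSup_of_le ⟨s.1, s.2.trans_le hkl⟩ le_rfl

omit mΩ in
lemma pastSigma_zero (G : Fin T → Ω → EuclideanSpace ℝ (Fin d)) : pastSigma G 0 = ⊥ :=
  iSup_eq_bot.2 fun s => absurd s.2 (Nat.not_lt_zero _)

omit mΩ in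
lemma comap_le_pastSigma (G : Fin T → Ω → EuclideanSpace ℝ (Fin d)) {s : Fin T} {k : ℕ}
    (h : (s : ℕ) < k) : MeasurableSpace.comap (G s) inferInstance ≤ pastSigma G k :=
  le_iSup_of_le (⟨s, h⟩ : {s : Fin T // (s : ℕ) < k}) le_rfl

omit [IsProbabilityMeasure P] in
lemma memLp_coord {X : Fin T → Ω → EuclideanSpace ℝ (Fin d)} (hX : ∀ t, MemLp (X t) 2 P)
    (p : Fin d × Fin T) : MemLp (coord X p) 2 P :=
  (EuclideanSpace.proj (𝕜 := ℝ) p.1 : EuclideanSpace ℝ (Fin d) →L[ℝ] ℝ).comp_memLp' (hX p.2)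

omit [IsProbabilityMeasure P] in
lemma IsGaussianBasis.memLp {G : Fin T → Ω → EuclideanSpace ℝ (Fin d)} (hG : IsGaussianBasis P G)
    (t : Fin T) : MemLp (G t) 2 P := by
  have h : MemLp id 2 (P.map (G t)) := by
    rw [hG.law t]
    exact IsGaussian.memLp_two_id
  exact (memLp_map_measure_iff aestronglyMeasurable_id (hG.measurable t).aemeasurable).1 h

omit [IsProbabilityMeasure P] in
lemma IsGaussianBasis.integral_coord {G : Fin T → Ω → EuclideanSpace ℝ (Fin d)}
    (hG : IsGaussianBasis P G) (p : Fin d × Fin T) : ∫ ω, coord G p ω ∂P = 0 := by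
  let L : StrongDual ℝ (EuclideanSpace ℝ (Fin d)) := EuclideanSpace.proj p.1
  have h := integral_strongDual_stdGaussian L
  rw [← hG.law p.2, integral_map (hG.measurable p.2).aemeasurable
    L.continuous.aestronglyMeasurable] at h
  exact h

omit [IsProbabilityMeasure P] in
lemma measurable_coord {X : Fin T → Ω → EuclideanSpace ℝ (Fin d)} (hX : ∀ t, Measurable (X t))
    (p : Fin d × Fin T) : Measurable (coord X p) :=
  (EuclideanSpace.proj (𝕜 := ℝ) p.1 : EuclideanSpace ℝ (Fin d) →L[ℝ] ℝ).continuous.measurable.comp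
    (hX p.2)

omit [IsProbabilityMeasure P] in
lemma IsGaussianBasis.integral_coord_mul_coord {G : Fin T → Ω → EuclideanSpace ℝ (Fin d)}
    (hG : IsGaussianBasis P G) (p q : Fin d × Fin T) :
    ∫ ω, coord G p ω * coord G q ω ∂P = if p = q then 1 else 0 := by
  obtain ⟨i, s⟩ := p
  obtain ⟨j, r⟩ := q
  by_cases hsr : s = r
  · subst hsr
    have h := covarianceBilin_apply (μ := stdGaussian (EuclideanSpace ℝ (Fin d)))
      IsGaussian.memLp_two_id (EuclideanSpace.single i 1) (EuclideanSpace.single j 1)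
    rw [covarianceBilin_stdGaussian] at h
    have h0 : ∫ x, id x ∂(stdGaussian (EuclideanSpace ℝ (Fin d))) = 0 := integral_id_stdGaussian
    rw [h0] at h
    simp only [sub_zero, EuclideanSpace.inner_single_left, map_one, one_mul] at h
    rw [← hG.law s, integral_map (hG.measurable s).aemeasurable
      (Measurable.aestronglyMeasurable (by fun_prop))] at h
    change ∫ ω, (G s ω).ofLp i * (G s ω).ofLp j ∂P = _
    rw [← h]
    rw [innerSL_apply_apply ℝ, EuclideanSpace.inner_single_left]
    simp [Prod.ext_iff]
  · have hind : IndepFun (coord G (i, s)) (coord G (j, r)) P :=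
      (hG.indep.indepFun hsr).comp
        (EuclideanSpace.proj (𝕜 := ℝ) i : EuclideanSpace ℝ (Fin d) →L[ℝ] ℝ).continuous.measurable
        (EuclideanSpace.proj (𝕜 := ℝ) j : EuclideanSpace ℝ (Fin d) →L[ℝ] ℝ).continuous.measurable
    rw [hind.integral_fun_mul_eq_mul_integral
      (measurable_coord hG.measurable _).aestronglyMeasurable
      (measurable_coord hG.measurable _).aestronglyMeasurable, hG.integral_coord, zero_mul,
      if_neg (fun h => hsr (Prod.ext_iff.1 h).2)]

omit [IsProbabilityMeasure P] in
/-- The noise has orthonormal components. -/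
lemma IsGaussianBasis.integral_sum_mul_sum {G : Fin T → Ω → EuclideanSpace ℝ (Fin d)}
    (hG : IsGaussianBasis P G) (a b : Fin d × Fin T → ℝ) :
    ∫ ω, (∑ p, a p * coord G p ω) * (∑ q, b q * coord G q ω) ∂P = ∑ p, a p * b p := by
  have hint : ∀ p q : Fin d × Fin T,
      Integrable (fun ω => a p * b q * (coord G p ω * coord G q ω)) P := fun p q =>
    ((memLp_coord hG.memLp p).integrable_mul (memLp_coord hG.memLp q)).const_mul _
  have e : ∀ ω, (∑ p, a p * coord G p ω) * (∑ q, b q * coord G q ω) =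
      ∑ p, ∑ q, a p * b q * (coord G p ω * coord G q ω) := by
    intro ω
    rw [Finset.sum_mul_sum]
    exact Finset.sum_congr rfl fun p _ => Finset.sum_congr rfl fun q _ => by ring
  simp only [e]
  rw [integral_finsetSum _ fun p _ => integrable_finsetSum _ fun q _ => hint p q]
  refine Finset.sum_congr rfl fun p _ => ?_
  rw [integral_finsetSum _ fun q _ => hint p q]
  simp only [integral_const_mul, hG.integral_coord_mul_coord]
  simp

omit mΩ in
lemma coord_linProcess (G : Fin T → Ω → EuclideanSpace ℝ (Fin d)) (L : BMat T d)
    (p : Fin d × Fin T) (ω : Ω) : coord (linProcess G L) p ω = ∑ q, L p q * coord G q ω := by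
  rw [Fintype.sum_prod_type_right]
  simp [coord, linProcess, block, Matrix.mulVec, dotProduct]

lemma IsGaussianBasis.condExp_coord {G : Fin T → Ω → EuclideanSpace ℝ (Fin d)}
    (hG : IsGaussianBasis P G) (k : ℕ) (q : Fin d × Fin T) :
    P[coord G q | pastSigma G k] =ᵐ[P] fun ω => if (q.2 : ℕ) < k then coord G q ω else 0 := by
  have hle := pastSigma_le hG.measurable k
  have hm : ∀ m : MeasurableSpace Ω, MeasurableSpace.comap (G q.2) inferInstance ≤ m →
      StronglyMeasurable[m] (coord G q) := fun m h =>
    ((EuclideanSpace.proj (𝕜 := ℝ) q.1 :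
      EuclideanSpace ℝ (Fin d) →L[ℝ] ℝ).continuous.measurable.comp
        ((comap_measurable (G q.2)).mono h le_rfl)).stronglyMeasurable
  split_ifs with h
  · rw [condExp_of_stronglyMeasurable hle (hm _ (comap_le_pastSigma G h))
      ((memLp_coord hG.memLp q).integrable one_le_two)]
  · have hind : Indep (MeasurableSpace.comap (G q.2) inferInstance) (pastSigma G k) P := by
      have h1 := indep_iSup_of_disjoint (fun s => (hG.measurable s).comap_le) hG.indep
        (S := {q.2}) (T := {s | (s : ℕ) < k}) (by simpa using h)
      simpa [pastSigma, iSup_subtype] using h1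
    have h2 := condExp_indep_eq (hG.measurable q.2).comap_le hle (hm _ le_rfl) hind
    rwa [hG.integral_coord q] at h2

lemma IsGaussianBasis.condExp_linProcess {G : Fin T → Ω → EuclideanSpace ℝ (Fin d)}
    (hG : IsGaussianBasis P G) (L : BMat T d) (k : ℕ) (p : Fin d × Fin T) :
    P[coord (linProcess G L) p | pastSigma G k] =ᵐ[P]
      fun ω => ∑ q : Fin d × Fin T, (if (q.2 : ℕ) < k then L p q else 0) * coord G q ω := by
  have e : coord (linProcess G L) p = ∑ q, L p q • coord G q := by
    funext ω
    rw [coord_linProcess]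
    simp
  rw [e]
  have h1 := condExp_finsetSum (μ := P) (s := Finset.univ) (f := fun q => L p q • coord G q)
    (fun q _ => ((memLp_coord hG.memLp q).integrable one_le_two).smul _) (pastSigma G k)
  have h2 : ∀ q, P[L p q • coord G q | pastSigma G k] =ᵐ[P]
      L p q • P[coord G q | pastSigma G k] := fun q => condExp_smul _ _ _
  filter_upwards [h1, ae_all_iff.2 h2, ae_all_iff.2 (hG.condExp_coord k)] with ω h3 h4 h5
  rw [h3, Finset.sum_apply]
  refine Finset.sum_congr rfl fun q _ => ?_
  rw [h4, Pi.smul_apply, h5]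
  split_ifs <;> simp

lemma IsGaussianBasis.condGram_linProcess {G : Fin T → Ω → EuclideanSpace ℝ (Fin d)}
    (hG : IsGaussianBasis P G) (L : BMat T d) (k : ℕ) (p q : Fin d × Fin T) :
    condGram P G (linProcess G L) k p q =
      ∑ r : Fin d × Fin T, if (r.2 : ℕ) < k then L p r * L q r else 0 := by
  have h : condGram P G (linProcess G L) k p q =
      ∫ ω, (∑ r : Fin d × Fin T, (if (r.2 : ℕ) < k then L p r else 0) * coord G r ω) *
        (∑ r : Fin d × Fin T, (if (r.2 : ℕ) < k then L q r else 0) * coord G r ω) ∂P := by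
    refine integral_congr_ae ?_
    filter_upwards [hG.condExp_linProcess L k p, hG.condExp_linProcess L k q] with ω h1 h2
    rw [h1, h2]
  rw [h, hG.integral_sum_mul_sum]
  refine Finset.sum_congr rfl fun r _ => ?_
  split_ifs <;> simp

/-- The step from k to k + 1 reveals only the noise vector with index k, which enters LG through the
k-th block column. -/
lemma IsGaussianBasis.condGram_linProcess_succ_sub {G : Fin T → Ω → EuclideanSpace ℝ (Fin d)}
    (hG : IsGaussianBasis P G) (L : BMat T d) (k : Fin T) :
    condGram P G (linProcess G L) (k + 1) - condGram P G (linProcess G L) k =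
      colBlock L k * (colBlock L k)ᵀ := by
  ext p q
  rw [Matrix.sub_apply, hG.condGram_linProcess, hG.condGram_linProcess, ← Finset.sum_sub_distrib,
    Matrix.mul_apply, Fintype.sum_prod_type]
  refine Finset.sum_congr rfl fun i _ => ?_
  rw [Finset.sum_eq_single k]
  · simp [colBlock]
  · intro s _ hs
    have : (s : ℕ) ≠ k := fun h => hs (Fin.ext h)
    by_cases h1 : (s : ℕ) < k
    · simp [h1, h1.trans (Nat.lt_succ_self _)]
    · have h2 : ¬ (s : ℕ) < k + 1 := by omega
      simp [h1, h2]
  · simp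

lemma IsGaussianBasis.condGram_linProcess_zero {G : Fin T → Ω → EuclideanSpace ℝ (Fin d)}
    (hG : IsGaussianBasis P G) (L : BMat T d) : condGram P G (linProcess G L) 0 = 0 := by
  ext p q
  rw [hG.condGram_linProcess]
  simp

lemma IsGaussianBasis.trace_condGram_linProcess {G : Fin T → Ω → EuclideanSpace ℝ (Fin d)}
    (hG : IsGaussianBasis P G) (L : BMat T d) :
    (condGram P G (linProcess G L) T).trace = frob L ^ 2 := by
  rw [frob_sq, Matrix.trace, matInner]
  refine Finset.sum_congr rfl fun p _ => ?_
  rw [Matrix.diag_apply, hG.condGram_linProcess]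
  simp

omit mΩ [IsProbabilityMeasure P] in
lemma measurable_linProcess {G : Fin T → Ω → EuclideanSpace ℝ (Fin d)} {L : BMat T d}
    (hL : L ∈ bL T d) (t : Fin T) : Measurable[pastSigma G (t + 1)] (linProcess G L t) := by
  refine Finset.measurable_fun_sum _ fun s _ => ?_
  by_cases hts : t < s
  · have : block L t s = 0 := hL t s hts
    simp only [this, Matrix.zero_mulVec]
    exact measurable_const
  · exact (measurable_toLp_mulVec (block L t s)).comp ((comap_measurable (G s)).mono
      (comap_le_pastSigma G (Nat.lt_succ_of_le (not_lt.1 hts))) le_rfl)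

omit [IsProbabilityMeasure P] in
lemma IsGaussianBasis.isAdaptedL2_linProcess {G : Fin T → Ω → EuclideanSpace ℝ (Fin d)}
    (hG : IsGaussianBasis P G) {L : BMat T d} (hL : L ∈ bL T d) :
    IsAdaptedL2 P G (linProcess G L) := fun t =>
  ⟨measurable_linProcess hL t, memLp_finsetSum _ fun s _ =>
    (Matrix.toEuclideanCLM (n := Fin d) (𝕜 := ℝ) (block L t s)).comp_memLp' (hG.memLp s)⟩

omit mΩ [IsProbabilityMeasure P] in
lemma linProcess_sub (G : Fin T → Ω → EuclideanSpace ℝ (Fin d)) (L M : BMat T d) (t : Fin T)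
    (ω : Ω) : linProcess G L t ω - linProcess G M t ω = linProcess G (L - M) t ω := by
  ext i
  have h : ∀ A, (linProcess G A t ω).ofLp i = ∑ q, A (i, t) q * coord G q ω := fun A =>
    coord_linProcess G A (i, t) ω
  rw [PiLp.sub_apply, h, h, h, ← Finset.sum_sub_distrib]
  exact Finset.sum_congr rfl fun q _ => by rw [Matrix.sub_apply]; ring

omit mΩ [IsProbabilityMeasure P] in
lemma sum_norm_sq_eq_sum_coord (X : Fin T → Ω → EuclideanSpace ℝ (Fin d)) (ω : Ω) :
    ∑ t, ‖X t ω‖ ^ 2 = ∑ p, coord X p ω ^ 2 := by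
  rw [Fintype.sum_prod_type_right]
  refine Finset.sum_congr rfl fun t _ => ?_
  rw [EuclideanSpace.real_norm_sq_eq]
  rfl

omit [IsProbabilityMeasure P] in
lemma IsGaussianBasis.integral_norm_linProcess_sub {G : Fin T → Ω → EuclideanSpace ℝ (Fin d)}
    (hG : IsGaussianBasis P G) (L M : BMat T d) :
    ∫ ω, ∑ t, ‖(linProcess G L t ω - linProcess G M t ω)‖ ^ 2 ∂P = frob (L - M) ^ 2 := by
  simp only [linProcess_sub, sum_norm_sq_eq_sum_coord, coord_linProcess]
  rw [integral_finsetSum]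
  · rw [frob_sq, matInner]
    refine Finset.sum_congr rfl fun p _ => ?_
    simp only [sq]
    exact hG.integral_sum_mul_sum _ _
  · intro p _
    have := (memLp_finsetSum Finset.univ fun q (_ : q ∈ Finset.univ) =>
      (memLp_coord hG.memLp q).const_mul ((L - M) p q)).integrable_sq
    exact this

end Moments

/-! ### The adapted Wasserstein distance between linear processes -/

section AdaptedWasserstein

variable {Ω : Type*} [mΩ : MeasurableSpace Ω] {P : Measure Ω} [IsProbabilityMeasure P] {T d : ℕ}
  {G : Fin T → Ω → EuclideanSpace ℝ (Fin d)}

lemma IsAdaptedL2.condExp_coord {X : Fin T → Ω → EuclideanSpace ℝ (Fin d)}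
    (hG : IsGaussianBasis P G) (hX : IsAdaptedL2 P G X) (p : Fin d × Fin T) :
    P[coord X p | pastSigma G T] = coord X p := by
  have hmeas : Measurable[pastSigma G T] (coord X p) :=
    (EuclideanSpace.proj (𝕜 := ℝ) p.1 :
      EuclideanSpace ℝ (Fin d) →L[ℝ] ℝ).continuous.measurable.comp
        ((hX p.2).1.mono (pastSigma_mono G p.2.2) le_rfl)
  exact condExp_of_stronglyMeasurable (pastSigma_le hG.measurable T) hmeas.stronglyMeasurable
    ((memLp_coord (fun t => (hX t).2) p).integrable one_le_two)

omit [IsProbabilityMeasure P] in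
lemma IsAdaptedL2.measurable {X : Fin T → Ω → EuclideanSpace ℝ (Fin d)}
    (hG : IsGaussianBasis P G) (hX : IsAdaptedL2 P G X) (t : Fin T) : Measurable (X t) :=
  (hX t).1.mono (pastSigma_le hG.measurable _) le_rfl

/-- Processes with the same adapted law have the same conditional second moments. -/
lemma SameAdaptedLaw.condGram_eq [StandardBorelSpace Ω]
    {X Y : Fin T → Ω → EuclideanSpace ℝ (Fin d)}
    (hG : IsGaussianBasis P G) (hX : IsAdaptedL2 P G X) (hY : IsAdaptedL2 P G Y)
    (h : SameAdaptedLaw P G X Y) {k : ℕ} (hk : k ≤ T) : condGram P G X k = condGram P G Y k := by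
  have hXm : Measurable fun ω t => X t ω := measurable_pi_iff.2 (hX.measurable hG)
  have hYm : Measurable fun ω t => Y t ω := measurable_pi_iff.2 (hY.measurable hG)
  have hle : ∀ n, pastSigma G n ≤ mΩ := pastSigma_le hG.measurable
  let f : Fin d × Fin T → (Fin T → EuclideanSpace ℝ (Fin d)) → ℝ := fun p x => (x p.2).ofLp p.1
  have hf : ∀ p, Measurable (f p) := fun p =>
    (EuclideanSpace.proj (𝕜 := ℝ) p.1 :
      EuclideanSpace ℝ (Fin d) →L[ℝ] ℝ).continuous.measurable.comp (measurable_pi_apply p.2)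
  have hint : ∀ {Z : Fin T → Ω → EuclideanSpace ℝ (Fin d)}, IsAdaptedL2 P G Z →
      ∀ p, Integrable (coord Z p) P := fun hZ p =>
    (memLp_coord (fun t => (hZ t).2) p).integrable one_le_two
  have hlaw := SameNestedLaw.map_eq hle (T - 1) hXm hYm h
  have key : P.map (fun ω p => (P[coord X p | pastSigma G k]) ω) =
      P.map (fun ω p => (P[coord Y p | pastSigma G k]) ω) := by
    -- The nested law conditions at times 1, …, T - 1 only. Time 0 gives means and time T, by
    -- adaptedness, the coordinates themselves; both are read off the plain law.
    rcases Nat.eq_zero_or_pos k with rfl | hk0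
    · have e : ∀ p, ∫ ω, coord X p ω ∂P = ∫ ω, coord Y p ω ∂P := by
        intro p
        have h1 := integral_map (μ := P) hXm.aemeasurable (hf p).aestronglyMeasurable
        have h2 := integral_map (μ := P) hYm.aemeasurable (hf p).aestronglyMeasurable
        rw [hlaw, h2] at h1
        exact h1.symm
      simp only [pastSigma_zero, condExp_bot, e]
    · rcases Nat.lt_or_ge (T - 1) k with hlt | hge
      · obtain rfl : k = T := by omega
        simp only [hX.condExp_coord hG, hY.condExp_coord hG]
        have hfm : Measurable fun (x : Fin k → EuclideanSpace ℝ (Fin d)) p => f p x :=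
          measurable_pi_iff.2 hf
        have h1 := Measure.map_map (μ := P) hfm hXm
        have h2 := Measure.map_map (μ := P) hfm hYm
        rw [hlaw, h2] at h1
        exact h1.symm
      · exact SameNestedLaw.map_condExp_eq hle (pastSigma_mono G) (T - 1) hXm hYm h f hf
          (hint hX) (hint hY) k hk0 hge
  have hmom : ∀ (Z : Fin T → Ω → EuclideanSpace ℝ (Fin d)) (p q : Fin d × Fin T),
      condGram P G Z k p q =
        ∫ x, x p * x q ∂(P.map fun ω p => (P[coord Z p | pastSigma G k]) ω) := by
    intro Z p q
    have hm : Measurable fun ω p => (P[coord Z p | pastSigma G k]) ω := measurable_pi_iff.2 fun p =>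
      (stronglyMeasurable_condExp.measurable).mono (hle k) le_rfl
    exact (integral_map hm.aemeasurable (f := fun x : Fin d × Fin T → ℝ => x p * x q)
      (Measurable.aestronglyMeasurable (by fun_prop))).symm
  ext p q
  rw [hmom, hmom, key]

/-- The lower bound for the transport cost between adapted processes with the adapted laws of
`LG` and `MG`. -/
lemma frob_sub_sq_le_integral [StandardBorelSpace Ω] {X Y : Fin T → Ω → EuclideanSpace ℝ (Fin d)}
    (hG : IsGaussianBasis P G) {L M O : BMat T d} (hL : L ∈ bL T d) (hM : M ∈ bL T d)
    (hO : O ∈ Ostar L M) (hX : IsAdaptedL2 P G X) (hY : IsAdaptedL2 P G Y)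
    (hXL : SameAdaptedLaw P G X (linProcess G L)) (hYM : SameAdaptedLaw P G Y (linProcess G M)) :
    frob (L - M * O) ^ 2 ≤ ∫ ω, ∑ t, ‖X t ω - Y t ω‖ ^ 2 ∂P := by
  have hXp := memLp_coord fun t => (hX t).2
  have hYp := memLp_coord fun t => (hY t).2
  have hXg : ∀ k ≤ T, condGram P G X k = condGram P G (linProcess G L) k := fun k hk =>
    hXL.condGram_eq hG hX (hG.isAdaptedL2_linProcess hL) hk
  have hYg : ∀ k ≤ T, condGram P G Y k = condGram P G (linProcess G M) k := fun k hk =>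
    hYM.condGram_eq hG hY (hG.isAdaptedL2_linProcess hM) hk
  let x : ℕ → Fin d × Fin T → Lp ℝ 2 P := fun k p => condL2 P (pastSigma G k) (hXp p)
  let y : ℕ → Fin d × Fin T → Lp ℝ 2 P := fun k p => condL2 P (pastSigma G k) (hYp p)
  -- Both mixed products reduce to time k, so the correlation of increments is the increment of the
  -- correlation and telescopes.
  have hstep : ∀ {f g : Ω → ℝ} (hf : MemLp f 2 P) (hg : MemLp g 2 P) (k : ℕ),
      inner ℝ (condL2 P (pastSigma G (k + 1)) hf - condL2 P (pastSigma G k) hf)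
        (condL2 P (pastSigma G (k + 1)) hg - condL2 P (pastSigma G k) hg) =
      inner ℝ (condL2 P (pastSigma G (k + 1)) hf) (condL2 P (pastSigma G (k + 1)) hg) -
        inner ℝ (condL2 P (pastSigma G k) hf) (condL2 P (pastSigma G k) hg) := by
    intro f g hf hg k
    have h1 : ∀ {f g : Ω → ℝ} (hf : MemLp f 2 P) (hg : MemLp g 2 P),
        inner ℝ (condL2 P (pastSigma G k) hf) (condL2 P (pastSigma G (k + 1)) hg) =
        inner ℝ (condL2 P (pastSigma G k) hf) (condL2 P (pastSigma G k) hg) := by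
      intro f g hf hg
      rw [inner_condL2, inner_condL2]
      exact integral_condExp_mul_condExp_of_le (pastSigma_mono G (Nat.le_succ k))
        (pastSigma_le hG.measurable _) hf hg
    rw [inner_sub_left, inner_sub_right, inner_sub_right, h1 hf hg,
      real_inner_comm (condL2 P (pastSigma G k) hg) (condL2 P (pastSigma G (k + 1)) hf), h1 hg hf,
      real_inner_comm (condL2 P (pastSigma G k) hf) (condL2 P (pastSigma G k) hg)]
    ring
  have hxg : ∀ k p q, inner ℝ (x k p) (x k q) = condGram P G X k p q := fun k p q =>
    inner_condL2 _ _
  have hyg : ∀ k p q, inner ℝ (y k p) (y k q) = condGram P G Y k p q := fun k p q =>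
    inner_condL2 _ _
  have hinc : ∀ k : Fin T, ∑ p, inner ℝ (x (k + 1) p - x k p) (y (k + 1) p - y k p) ≤
      matInner (colBlock (M * O) k) (colBlock L k) := by
    intro k
    rw [matInner_eq_trace]
    refine sum_inner_le_trace (fun p q => ?_) (fun p q => ?_) ?_
    · rw [hstep, hxg, hxg, hXg _ k.2, hXg _ k.2.le, ← hG.condGram_linProcess_succ_sub L k,
        Matrix.sub_apply]
    · have e : colBlock (M * O) k * (colBlock (M * O) k)ᵀ = colBlock M k * (colBlock M k)ᵀ := by
        obtain ⟨U, hU, hOU⟩ := hO.1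
        have h1 : U k * (U k)ᵀ = 1 := by
          simpa [Matrix.star_eq_conjTranspose] using
            (Matrix.mem_orthogonalGroup_iff (Fin d) ℝ).1 (hU k)
        rw [hOU, colBlock_mul_blockDiagonal, Matrix.transpose_mul, Matrix.mul_assoc,
          ← Matrix.mul_assoc (U k), h1, Matrix.one_mul]
      rw [hstep, hyg, hyg, hYg _ k.2, hYg _ k.2.le, e, ← hG.condGram_linProcess_succ_sub M k,
        Matrix.sub_apply]
    -- Optimality of O provides exactly the positive semidefiniteness that the trace bound requires.
    · rw [← block_transpose_mul]
      obtain ⟨h1, h2⟩ := isSymm_and_nonneg_of_mem_Ostar hO k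
      refine Matrix.posSemidef_iff_dotProduct_mulVec.2 ⟨?_, fun v => by simpa using h2 v⟩
      rw [Matrix.IsHermitian, Matrix.conjTranspose_eq_transpose_of_trivial]
      exact h1
  -- LG is centred, so the telescoping sum has no initial term.
  have hzero : ∀ p, x 0 p = 0 := by
    intro p
    rw [← inner_self_eq_zero (𝕜 := ℝ), hxg, hXg 0 (Nat.zero_le T), hG.condGram_linProcess_zero]
    rfl
  have hcross : ∑ p, inner ℝ (x T p) (y T p) ≤ matInner (M * O) L := by
    have e : ∑ p, inner ℝ (x T p) (y T p) =
        ∑ k ∈ Finset.range T, ∑ p, inner ℝ (x (k + 1) p - x k p) (y (k + 1) p - y k p) := by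
      have h1 : ∀ k, ∑ p, inner ℝ (x (k + 1) p - x k p) (y (k + 1) p - y k p) =
          ∑ p, inner ℝ (x (k + 1) p) (y (k + 1) p) - ∑ p, inner ℝ (x k p) (y k p) := by
        intro k
        rw [← Finset.sum_sub_distrib]
        exact Finset.sum_congr rfl fun p _ => hstep _ _ k
      simp only [h1]
      rw [Finset.sum_range_sub (fun k => ∑ p, inner ℝ (x k p) (y k p))]
      simp [hzero]
    rw [e, Finset.sum_range, matInner_eq_sum_colBlock]
    exact Finset.sum_le_sum fun k _ => hinc k
  have hcost : ∫ ω, ∑ t, ‖X t ω - Y t ω‖ ^ 2 ∂P = ∑ p, ‖x T p - y T p‖ ^ 2 := by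
    have h1 : ∀ ω, ∑ t, ‖X t ω - Y t ω‖ ^ 2 = ∑ p, (coord X p ω - coord Y p ω) ^ 2 := fun ω =>
      sum_norm_sq_eq_sum_coord (fun t ω => X t ω - Y t ω) ω
    simp only [h1]
    have h2 : ∀ p, Integrable (fun ω => (coord X p ω - coord Y p ω) ^ 2) P := fun p =>
      ((hXp p).sub (hYp p)).integrable_sq
    rw [integral_finsetSum _ fun p _ => h2 p]
    refine Finset.sum_congr rfl fun p _ => ?_
    rw [← real_inner_self_eq_norm_sq, L2.inner_def]
    refine integral_congr_ae ?_
    filter_upwards [Lp.coeFn_sub (x T p) (y T p),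
      ((hXp p).condExp (m := pastSigma G T) one_le_two).coeFn_toLp,
      ((hYp p).condExp (m := pastSigma G T) one_le_two).coeFn_toLp] with ω h2 h3 h4
    have h5 : (x T p : Ω → ℝ) ω = coord X p ω := by rw [← hX.condExp_coord hG p]; exact h3
    have h6 : (y T p : Ω → ℝ) ω = coord Y p ω := by rw [← hY.condExp_coord hG p]; exact h4
    rw [h2, Pi.sub_apply, h5, h6]
    simp [sq]
  have hnorm : ∑ p, ‖x T p - y T p‖ ^ 2 =
      frob L ^ 2 + frob M ^ 2 - 2 * ∑ p, inner ℝ (x T p) (y T p) := by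
    rw [← hG.trace_condGram_linProcess L, ← hG.trace_condGram_linProcess M, ← hXg T le_rfl,
      ← hYg T le_rfl, Matrix.trace, Matrix.trace, Finset.mul_sum, ← Finset.sum_add_distrib,
      ← Finset.sum_sub_distrib]
    refine Finset.sum_congr rfl fun p _ => ?_
    rw [norm_sub_sq_real, Matrix.diag_apply, Matrix.diag_apply, ← hxg, ← hyg,
      real_inner_self_eq_norm_sq, real_inner_self_eq_norm_sq]
    ring
  rw [hcost, hnorm, frob_sub_sq, frob_mul M hO.1, matInner_comm]
  linarith

/-- The adapted Wasserstein distance between `LG` and `MG` is the distance between the `𝐎`-orbits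
of `L` and `M`. -/
lemma dABW_eq_orbitDist [StandardBorelSpace Ω] (hG : IsGaussianBasis P G) (L M : bL T d) :
    dABW P G L.1 M.1 = orbitDist L.1 M.1 := by
  obtain ⟨O, hO⟩ := exists_mem_Ostar L.1 M.1
  rw [orbitDist_eq hO, dABW, adaptedW2, ← Real.sqrt_sq (frob_nonneg (L.1 - M.1 * O))]
  congr 1
  refine IsLeast.csInf_eq ⟨?_, ?_⟩
  -- The infimum is attained by driving both processes with the same noise after rotating M
  -- optimally.
  · refine ⟨linProcess G L.1, linProcess G (M.1 * O), hG.isAdaptedL2_linProcess L.2,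
      hG.isAdaptedL2_linProcess (mul_mem_bL M.2 hO.1), ?_, sameAdaptedLaw_linProcess_mul hG M.1 hO.1,
      (hG.integral_norm_linProcess_sub _ _).symm⟩
    simpa using sameAdaptedLaw_linProcess_mul hG L.1 (bO_one T d)
  · rintro c ⟨X, Y, hX, hY, hXL, hYM, rfl⟩
    exact frob_sub_sq_le_integral hG L.2 M.2 hO hX hY hXL hYM

end AdaptedWasserstein

end AdaptedBW

end

/-- The existential quantifiers leave no freedom in the distances: every point is a class, so the
metric is prescribed on all pairs, and the limits determine the angles because these lie in [0, π].
-/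
theorem theorem1p7 {Ω : Type*} [MeasurableSpace Ω] [StandardBorelSpace Ω]
    (P : Measure Ω) [IsProbabilityMeasure P] {T d : ℕ} (hT : 0 < T) (hd : 0 < d)
    (G : Fin T → Ω → EuclideanSpace ℝ (Fin d)) (hG : AdaptedBW.IsGaussianBasis P G) :
    ∃ m : MetricSpace (AdaptedBW.ABWSpace T d),
      (∀ A B : AdaptedBW.bL T d,
        dist (AdaptedBW.cls A) (AdaptedBW.cls B) = AdaptedBW.dABW P G A.1 B.1) ∧
      ∀ L : AdaptedBW.bL T d,
        ∃ a : PseudoMetricSpace (AdaptedBW.Geod (AdaptedBW.cls L)),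
          AdaptedBW.IsAngleMetric (AdaptedBW.cls L) a ∧
          ∃ ι : AdaptedBW.TangentCone (AdaptedBW.cls L) → AdaptedBW.VQuot L.1,
            Function.Bijective ι ∧
            ∀ p q : AdaptedBW.TangentCone (AdaptedBW.cls L),
              dist (ι p) (ι q) = AdaptedBW.coneDist p q :=
  ⟨AdaptedBW.orbitMetricSpace T d, fun A B => (AdaptedBW.dABW_eq_orbitDist hG A B).symm, fun L =>
    ⟨AdaptedBW.angleMetric L, AdaptedBW.isAngleMetric_angleMetric L, AdaptedBW.coneIso L,
      AdaptedBW.coneIso_bijective hT hd L, AdaptedBW.dist_coneIso L⟩⟩
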